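/- **Setting.** Let $M$ be a real smooth 4-manifold with a conformal class $[g]$ of metrics of any signature, let $g\in[g]$, and let $(M,g)$ carry a (complexified) spin structure, so that locally $TM\otimes\mathbb C=\mathbb S\otimes\mathbb S'$ (abstract indices $a=AA'$) with $g_{ab}=\epsilon_{AB}\epsilon_{A'B'}$. Indices are moved by $\varphi^A=\epsilon^{AB}\varphi_B$, $\varphi_A=\epsilon_{BA}\varphi^B$, where $\epsilon^{AC}\epsilon_{BC}=\delta^A{}_B$, and similarly for primed indices. Let $\nabla_{AA'}$ be the Levi-Civita connection of $g$ on tensors and spinors. Let $[\beta_A]$ be a projective spinor field (a nowhere vanishing spinor field up to multiplication by nowhere vanishing smooth complex functions) whose representatives satisfy $$\beta^A\beta^B\nabla_{AA'}\beta_B=0 .$$ Let $\beta_A$ be a representative, let $\alpha_A$ be any spinor field such that $\phi:=\alpha_A\beta^A$ vanishes nowhere, and let $w_0,w_1\in\mathbb R$. **The gauge-covariant derivative.** Put $K^a{}_b=\phi^{-1}(\alpha^A\beta_B+\beta^A\alpha_B)\delta^{A'}{}_{B'}$, $\omega_{ab}=g_{cb}K^c{}_a$, and let $f_a=\tfrac14\,\omega^{bc}(d\omega)_{abc}$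 be the Lee form of $K$. Put $$L_{AA'}=\phi^{-1}\beta_B\nabla_{AA'}\alpha^B+\phi^{-1}\beta_Af_{A'B}\alpha^B-w_0f_{AA'},\qquad M_{AA'}=-\phi^{-1}\alpha_B\nabla_{AA'}\beta^B-\phi^{-1}\alpha_Af_{A'B}\beta^B-w_1f_{AA'} .$$ On scalar fields $s$ and primed spinor fields $\psi^{B'}$ of type $(r,r';w)$ put $$\mathcal C_{AA'}s=\nabla_{AA'}s+(wf_{AA'}+rL_{AA'}+r'M_{AA'})s,$$ $$\mathcal C_{AA'}\psi^{B'}=\nabla_{AA'}\psi^{B'}+\delta_{A'}{}^{B'}f_{AX'}\psi^{X'}+(wf_{AA'}+rL_{AA'}+r'M_{AA'})\psi^{B'},$$ and $\mathcal C_{A'}=\beta^A\mathcal C_{AA'}$. **The bundle.** Let $L=\{\beta^A\nu^{A'}\}\subset TM\otimes\mathbb C$, a complex vector bundle of rank 2, and $P^a{}_b=\phi^{-1}\beta^A\alpha_B\delta^{A'}{}_{B'}$. For $X\in\Gamma(L)$ write $X^{AA'}=\beta^Ax^{A'}$ with $x^{A'}=\phi^{-1}\alpha_BX^{BA'}$,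 of type $(0,-1;-w_1)$, and likewise $y^{A'}$ for $Y$. For $\omega\in\Gamma(L^*)$ write $\omega_{AA'}=\alpha_A\omega_{A'}$ with $\omega_{A'}=\phi^{-1}\beta^B\omega_{BA'}$, of type $(-1,0;-w_0-1)$; then $\omega^{A'}$ has type $(-1,0;-w_0-2)$ and the scalar $x^{B'}\omega_{B'}$ has type $(-1,-1;-w_0-w_1-1)$. **Claim.** 1. There is a complex Lie algebroid $(L,[\cdot,\cdot]_L,P)$ (a $\mathbb C$-bilinear skew bracket on $\Gamma(L)$ satisfying the Jacobi identity, $P[X,Y]_L=[PX,PY]$ and $[X,fY]_L=((PX)f)Y+f[X,Y]_L$) whose anchor is $P|_L$ and whose bracket is $$[X,Y]_L^{AA'}=\beta^A\left(x^{B'}\mathcal C_{B'}y^{A'}-y^{B'}\mathcal C_{B'}x^{A'}\right).$$ 2. Let $\Lambda^k=\wedge^kL^*$ and let $d^L$ be the exterior derivative of this Lie algebroid, $$(d^L\omega)(X_0,\dots,X_k)=\sum_i(-1)^iP(X_i)\,\omega(X_0,\dots,\hat X_i,\dots,X_k)+\sum_{i<j}(-1)^{i+j}\omega([X_i,X_j]_L,X_0,\dots,\hat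 X_i,\dots,\hat X_j,\dots,X_k).$$ Then $$(d^Lf)_{AA'}=\phi^{-1}\alpha_A\,\mathcal C_{A'}f\quad (f\in C^\infty(M,\mathbb C)),\qquad (d^L\omega)_{AA'BB'}=\phi^{-1}(\mathcal C_{C'}\omega^{C'})\,\alpha_A\alpha_B\,\epsilon_{A'B'}\quad(\omega\in\Gamma(L^*)),$$ and $d^L\omega=0$ for every $\omega\in\Gamma(\Lambda^k)$ with $k\ge2$. 3. The generalized Lie derivative $\pounds^L_X\omega=i_Xd^L\omega+d^Li_X\omega$ of $\omega\in\Gamma(L^*)$ along $X\in\Gamma(L)$ is $$(\pounds^L_X\omega)_{AA'}=\alpha_A\left[x_{A'}(\mathcal C_{B'}\omega^{B'})+\mathcal C_{A'}(x^{B'}\omega_{B'})\right].$$ -/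

import Mathlib

open scoped Manifold ContDiff TensorProduct

noncomputable section

universe u v

namespace ShearFree

/-! ### Complex vector fields on a real 4-manifold -/

/-- The model of a real 4-dimensional smooth manifold. -/
abbrev E4 : Type := EuclideanSpace ℝ (Fin 4)

section ComplexTangent

variable {M : Type u} [TopologicalSpace M] [ChartedSpace E4 M]

/-- The fibre at `x` of the complexified tangent bundle `TM ⊗ ℂ`. -/
abbrev CT (x : M) : Type := ℂ ⊗[ℝ] TangentSpace (𝓡 4) x

/-- The real part of a complex tangent vector. -/
def reT {x : M} (v : CT x) : TangentSpace (𝓡 4) x :=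
  TensorProduct.lid ℝ _ (LinearMap.rTensor _ Complex.reLm v)

/-- The imaginary part of a complex tangent vector. -/
def imT {x : M} (v : CT x) : TangentSpace (𝓡 4) x :=
  TensorProduct.lid ℝ _ (LinearMap.rTensor _ Complex.imLm v)

/-- The complex tangent vector `v + i w`. -/
def mkT {x : M} (v w : TangentSpace (𝓡 4) x) : CT x :=
  (1 : ℂ) ⊗ₜ[ℝ] v + Complex.I ⊗ₜ[ℝ] w

/-- Smoothness on `U` of a complex-valued function. -/
abbrev SmoothOn (f : M → ℂ) (U : Set M) : Prop :=
  ContMDiffOn (𝓡 4) 𝓘(ℝ, ℂ) ∞ f U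

theorem smoothOn_mul {f h : M → ℂ} {U : Set M} (hf : SmoothOn f U) (hh : SmoothOn h U) :
    SmoothOn (fun x => f x * h x) U :=
  (contDiff_mul (𝕜 := ℝ) (𝔸 := ℂ) (n := ∞)).contMDiff.comp_contMDiffOn (hf.prodMk_space hh)

variable [IsManifold (𝓡 4) ∞ M]

/-- Smoothness on `U` of a complex vector field: its real and imaginary parts are smooth. -/
def VFSmoothOn (X : ∀ x : M, CT x) (U : Set M) : Prop :=
  ContMDiffOn (𝓡 4) (𝓡 4).tangent ∞
      (fun x => (⟨x, reT (X x)⟩ : TangentBundle (𝓡 4) M)) U ∧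
    ContMDiffOn (𝓡 4) (𝓡 4).tangent ∞
      (fun x => (⟨x, imT (X x)⟩ : TangentBundle (𝓡 4) M)) U

/-- The derivative `v f` of a complex-valued function along a complex tangent vector. -/
def dirDeriv (f : M → ℂ) (x : M) (v : CT x) : ℂ :=
  let df : TangentSpace (𝓡 4) x →L[ℝ] ℂ := mfderiv (𝓡 4) 𝓘(ℝ, ℂ) f x
  df (reT v) + Complex.I * df (imT v)

/-- The complex-bilinear extension of the Lie bracket of vector fields. -/
def lieC (X Y : ∀ x : M, CT x) (x : M) : CT x :=
  mkT
    (VectorField.mlieBracket (𝓡 4) (fun y => reT (X y)) (fun y => reT (Y y)) x -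
      VectorField.mlieBracket (𝓡 4) (fun y => imT (X y)) (fun y => imT (Y y)) x)
    (VectorField.mlieBracket (𝓡 4) (fun y => reT (X y)) (fun y => imT (Y y)) x +
      VectorField.mlieBracket (𝓡 4) (fun y => imT (X y)) (fun y => reT (Y y)) x)

end ComplexTangent

/-! ### Smooth complex vector bundles over a real 4-manifold -/

section Bundles

/-- A smooth complex vector bundle of rank `r`, given by its fibres and by a covering family of
local frames that are related by smooth transition matrices. -/
structure SmoothCBundle (M : Type u) [TopologicalSpace M] [ChartedSpace E4 M] (r : ℕ) where
  Fib : M → Type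
  [addCommGroup : ∀ x, AddCommGroup (Fib x)]
  [module : ∀ x, Module ℂ (Fib x)]
  ι : Type v
  U : ι → Set M
  isOpen_U : ∀ i, IsOpen (U i)
  cover : ∀ x, ∃ i, x ∈ U i
  frame : ∀ i x, x ∈ U i → Module.Basis (Fin r) ℂ (Fib x)
  transition : ∀ i j, ∃ T : Fin r → Fin r → M → ℂ,
    (∀ l k, SmoothOn (T l k) (U i ∩ U j)) ∧
      ∀ x (hi : x ∈ U i) (hj : x ∈ U j) (k : Fin r),
        frame j x hj k = ∑ l, T l k x • frame i x hi l

attribute [instance] SmoothCBundle.addCommGroup SmoothCBundle.module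

variable {M : Type u} [TopologicalSpace M] [ChartedSpace E4 M] {r : ℕ}

/-- A section of a bundle is smooth if its components in the local frames are. -/
def IsSmoothSection (B : SmoothCBundle M r) (X : ∀ x, B.Fib x) : Prop :=
  ∀ i, ∃ c : Fin r → M → ℂ, (∀ k, SmoothOn (c k) (B.U i)) ∧
    ∀ x (hi : x ∈ B.U i), X x = ∑ k, c k x • B.frame i x hi k

/-- The complex vector space `Γ(B)` of smooth global sections. -/
def Γ (B : SmoothCBundle M r) : Submodule ℂ (∀ x, B.Fib x) where
  carrier := {X | IsSmoothSection B X}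
  add_mem' := by
    intro X Y hX hY i
    obtain ⟨c, hc, hc'⟩ := hX i
    obtain ⟨d, hd, hd'⟩ := hY i
    refine ⟨fun k x => c k x + d k x, fun k => (hc k).add (hd k), fun x hx => ?_⟩
    simp only [Pi.add_apply, hc' x hx, hd' x hx, add_smul, Finset.sum_add_distrib]
  zero_mem' := by
    intro i
    exact ⟨fun _ _ => 0, fun _ => contMDiffOn_const, fun x hx => by simp⟩
  smul_mem' := by
    intro a X hX i
    obtain ⟨c, hc, hc'⟩ := hX i
    refine ⟨fun k x => a * c k x, fun k => smoothOn_mul contMDiffOn_const (hc k), fun x hx => ?_⟩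
    simp only [Pi.smul_apply, hc' x hx, Finset.smul_sum, mul_smul]

/-- The product `f X` of a smooth complex-valued function and a section. -/
def fsmul {B : SmoothCBundle M r} (f : C^∞⟮𝓡 4, M; 𝓘(ℝ, ℂ), ℂ⟯) (X : Γ B) : Γ B :=
  ⟨fun x => f x • X.1 x, by
    intro i
    obtain ⟨c, hc, hc'⟩ := X.2 i
    refine ⟨fun k x => f x * c k x, fun k => smoothOn_mul f.contMDiff.contMDiffOn (hc k), fun x hx => ?_⟩
    simp only [hc' x hx, Finset.smul_sum, mul_smul]⟩

/-- Sections of `Λᵏ = ∧ᵏ B*`: smooth fields of alternating complex `k`-forms on the fibres. -/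
structure BForm (B : SmoothCBundle M r) (k : ℕ) where
  toFun : ∀ x, (B.Fib x) [⋀^Fin k]→ₗ[ℂ] ℂ
  smooth : ∀ i (J : Fin k → Fin r), ∃ c : M → ℂ, SmoothOn c (B.U i) ∧
    ∀ x (hi : x ∈ B.U i), toFun x (fun m => B.frame i x hi (J m)) = c x

/-! ### Complex Lie algebroids -/

variable [IsManifold (𝓡 4) ∞ M]

/-- A complex Lie algebroid on the bundle `B`, with an anchor to `TM ⊗ ℂ`. -/
structure LieAlgebroid (B : SmoothCBundle M r) where
  bracket : Γ B →ₗ[ℂ] Γ B →ₗ[ℂ] Γ B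
  anchor : ∀ x, B.Fib x →ₗ[ℂ] CT x
  anchor_smooth : ∀ i (k : Fin r), ∃ V : ∀ x : M, CT x, VFSmoothOn V (B.U i) ∧
    ∀ x (hi : x ∈ B.U i), anchor x (B.frame i x hi k) = V x
  skew : ∀ X Y, bracket X Y = -bracket Y X
  jacobi : ∀ X Y Z,
    bracket X (bracket Y Z) + bracket Z (bracket X Y) + bracket Y (bracket Z X) = 0
  anchor_bracket : ∀ (X Y : Γ B) (x : M),
    anchor x ((bracket X Y).1 x) =
      lieC (fun y => anchor y (X.1 y)) (fun y => anchor y (Y.1 y)) x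
  leibniz : ∀ (X Y : Γ B) (f : C^∞⟮𝓡 4, M; 𝓘(ℝ, ℂ), ℂ⟯) (x : M),
    (bracket X (fsmul f Y)).1 x =
      dirDeriv f x (anchor x (X.1 x)) • Y.1 x + f x • (bracket X Y).1 x

/-- A function-valued function of `k` sections. The operators `d` and `i_X` are given by what they
do on sections; the forms are embedded by `BForm.cochain`, the functions by `cochain₀`. -/
abbrev Cochain (B : SmoothCBundle M r) (k : ℕ) : Type _ := (Fin k → Γ B) → M → ℂ

/-- The cochain `(X₁, …, X_k) ↦ η(X₁, …, X_k)` of a `k`-form `η`. -/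
def BForm.cochain {B : SmoothCBundle M r} {k : ℕ} (η : BForm B k) : Cochain B k :=
  fun X x => η.toFun x (fun m => (X m).1 x)

/-- A smooth function as an element of `Γ(Λ⁰)`. -/
def cochain₀ (B : SmoothCBundle M r) (f : C^∞⟮𝓡 4, M; 𝓘(ℝ, ℂ), ℂ⟯) : Cochain B 0 :=
  fun _ => f

namespace LieAlgebroid

variable {B : SmoothCBundle M r} (𝓐 : LieAlgebroid B)

/-- The first sum `∑ᵢ (-1)ⁱ ρ(Xᵢ) η(X₀, …, X̂ᵢ, …, X_k)` of the exterior derivative. -/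
def extD₁ {k : ℕ} (η : Cochain B k) : Cochain B (k + 1) := fun X x =>
  ∑ i : Fin (k + 1), (-1 : ℂ) ^ (i : ℕ) *
    dirDeriv (η (fun m => X (i.succAbove m))) x (𝓐.anchor x ((X i).1 x))

/-- The second sum `∑_{i<j} (-1)ⁱ⁺ʲ η([Xᵢ, Xⱼ], X₀, …, X̂ᵢ, …, X̂ⱼ, …, X_k)` of the exterior
derivative. For `i < j` the sections other than `Xᵢ` and `Xⱼ` are `X (j.succAbove (i.succAbove m))`. -/
def extD₂ {k : ℕ} (η : Cochain B (k + 1)) : Cochain B (k + 2) := fun X x =>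
  ∑ j : Fin (k + 2), ∑ i : Fin (k + 1),
    if i.castSucc < j then
      (-1 : ℂ) ^ ((i : ℕ) + (j : ℕ)) *
        η (Fin.cons (𝓐.bracket (X i.castSucc) (X j))
          (fun m : Fin k => X (j.succAbove (i.succAbove m)))) x
    else 0

/-- The Lie algebroid exterior derivative `d^L`. -/
def extD : ∀ {k : ℕ}, Cochain B k → Cochain B (k + 1)
  | 0, η => 𝓐.extD₁ η
  | _ + 1, η => fun X x => 𝓐.extD₁ η X x + 𝓐.extD₂ η X x

/-- The interior product `i_X η = η(X, …)`. -/
def interior {k : ℕ} (X : Γ B) (η : Cochain B (k + 1)) : Cochain B k :=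
  fun Y => η (Fin.cons X Y)

/-- The generalized Lie derivative `i_X d^L η + d^L i_X η` (where `i_X η = 0` in degree 0). -/
def lieD : ∀ {k : ℕ}, Γ B → Cochain B k → Cochain B k
  | 0, X, η => interior X (𝓐.extD η)
  | _ + 1, X, η => fun Y x => interior X (𝓐.extD η) Y x + 𝓐.extD (interior X η) Y x

end LieAlgebroid

end Bundles

/-! ### Conformal structures and spin structures -/

section Conformal

/-- A smooth metric of arbitrary signature. -/
structure Metric (M : Type u) [TopologicalSpace M] [ChartedSpace E4 M] [IsManifold (𝓡 4) ∞ M] where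
  form : ∀ x : M, TangentSpace (𝓡 4) x →L[ℝ] TangentSpace (𝓡 4) x →L[ℝ] ℝ
  symm : ∀ x v w, form x v w = form x w v
  nondegenerate : ∀ x v, (∀ w, form x v w = 0) → v = 0
  smooth : ContMDiff (𝓡 4) ((𝓡 4).prod 𝓘(ℝ, E4 →L[ℝ] E4 →L[ℝ] ℝ)) ∞
    (fun x => Bundle.TotalSpace.mk' (E4 →L[ℝ] E4 →L[ℝ] ℝ) x (form x))

variable {M : Type u} [TopologicalSpace M] [ChartedSpace E4 M] [IsManifold (𝓡 4) ∞ M]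

/-- The complex-bilinear extension of the metric to `TM ⊗ ℂ`. -/
def Metric.formC (g : Metric M) (x : M) : LinearMap.BilinForm ℂ (CT x) :=
  LinearMap.BilinForm.baseChange ℂ
    ((ContinuousLinearMap.coeLM ℝ).comp (g.form x).toLinearMap :
      LinearMap.BilinForm ℝ (TangentSpace (𝓡 4) x))

/-- A conformal class of metrics `[g] = {Ω² g}`. -/
structure ConformalStructure (M : Type u) [TopologicalSpace M] [ChartedSpace E4 M]
    [IsManifold (𝓡 4) ∞ M] where
  reps : Set (Metric M)
  nonempty : reps.Nonempty
  mem_iff : ∀ g ∈ reps, ∀ g' : Metric M, g' ∈ reps ↔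
    ∃ Ω : C^∞⟮𝓡 4, M; 𝓘(ℝ, ℝ), ℝ⟯, (∀ x, 0 < Ω x) ∧
      ∀ x v w, g'.form x v w = (Ω x) ^ 2 * g.form x v w

/-- The components of `ε_{AB}` and of `ε^{AB}` in a normalized spin frame (they agree, by the
convention `ε^{AC} ε_{BC} = δ^A_B`); the same matrix serves for primed indices. -/
def eps : Fin 2 → Fin 2 → ℂ := ![![0, 1], ![-1, 0]]

/-- `φ_A = ε_{BA} φ^B`. -/
def lower (φ : Fin 2 → ℂ) (A : Fin 2) : ℂ := ∑ B, eps B A * φ B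

/-- `φ^A = ε^{AB} φ_B`. -/
def raise (φ : Fin 2 → ℂ) (A : Fin 2) : ℂ := ∑ B, eps A B * φ B

/-- The Kronecker delta. -/
def kron (A B : Fin 2) : ℂ := if A = B then 1 else 0

/-- A (complex) spin structure on `(M, g)`: over the sets `U i` of an open cover there are local
frames `e_{AA'} = o_A ⊗ o_{A'}` of `TM ⊗ ℂ` with `g(e_{AA'}, e_{BB'}) = ε_{AB} ε_{A'B'}`, and the
normalized spin frames `o_A` and `o_{A'}` change from `U i` to `U j` by smooth `SL(2, ℂ)`-valued
functions `Λ i j` and `Λ' i j` that satisfy the cocycle condition. These are the transition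
functions of the spinor bundles `𝕊` and `𝕊'`. -/
structure SpinStructure (g : Metric M) where
  ι : Type v
  U : ι → Set M
  isOpen_U : ∀ i, IsOpen (U i)
  cover : ∀ x, ∃ i, x ∈ U i
  e : ι → ∀ x : M, Module.Basis (Fin 2 × Fin 2) ℂ (CT x)
  e_smooth : ∀ i a, VFSmoothOn (fun x => e i x a) (U i)
  e_metric : ∀ i, ∀ x ∈ U i, ∀ a b,
    g.formC x (e i x a) (e i x b) = eps a.1 b.1 * eps a.2 b.2
  Λ : ι → ι → M → Matrix (Fin 2) (Fin 2) ℂ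
  Λ' : ι → ι → M → Matrix (Fin 2) (Fin 2) ℂ
  Λ_smooth : ∀ i j A B, SmoothOn (fun x => Λ i j x A B) (U i ∩ U j)
  Λ'_smooth : ∀ i j A B, SmoothOn (fun x => Λ' i j x A B) (U i ∩ U j)
  Λ_det : ∀ i j, ∀ x ∈ U i ∩ U j, (Λ i j x).det = 1
  Λ'_det : ∀ i j, ∀ x ∈ U i ∩ U j, (Λ' i j x).det = 1
  Λ_cocycle : ∀ i j k, ∀ x ∈ U i ∩ U j ∩ U k, Λ i j x * Λ j k x = Λ i k x
  Λ'_cocycle : ∀ i j k, ∀ x ∈ U i ∩ U j ∩ U k, Λ' i j x * Λ' j k x = Λ' i k x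
  e_transition : ∀ i j, ∀ x ∈ U i ∩ U j, ∀ A A',
    e j x (A, A') = ∑ B, ∑ B', (Λ i j x B A * Λ' i j x B' A') • e i x (B, B')

variable {g : Metric M}

/-- A smooth section `ξ^A` of `𝕊`, given by its components in the local spin frames. -/
structure SpinorField (𝔖 : SpinStructure g) where
  comp : 𝔖.ι → M → Fin 2 → ℂ
  smooth : ∀ i A, SmoothOn (fun x => comp i x A) (𝔖.U i)
  transition : ∀ i j, ∀ x ∈ 𝔖.U i ∩ 𝔖.U j, comp i x = (𝔖.Λ i j x).mulVec (comp j x)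

/-- A projective spinor field: a class of nowhere vanishing spinor fields up to rescaling by
nowhere vanishing smooth complex functions. -/
structure ProjectiveSpinorField (𝔖 : SpinStructure g) where
  reps : Set (SpinorField 𝔖)
  nonempty : reps.Nonempty
  ne_zero : ∀ β ∈ reps, ∀ i, ∀ x ∈ 𝔖.U i, β.comp i x ≠ 0
  mem_iff : ∀ β ∈ reps, ∀ β' : SpinorField 𝔖, β' ∈ reps ↔
    ∃ μ : C^∞⟮𝓡 4, M; 𝓘(ℝ, ℂ), ℂ⟯, (∀ x, μ x ≠ 0) ∧
      ∀ i, ∀ x ∈ 𝔖.U i, β'.comp i x = μ x • β.comp i x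

namespace SpinStructure

variable (𝔖 : SpinStructure g) (i : 𝔖.ι)

/-- The derivative `e_{AA'} f`. -/
def der (x : M) (a : Fin 2 × Fin 2) (f : M → ℂ) : ℂ := dirDeriv f x (𝔖.e i x a)

/-- The bracket `[e_a, e_b]` of two frame fields. -/
def frameBracket (x : M) (a b : Fin 2 × Fin 2) : CT x :=
  lieC (fun y => 𝔖.e i y a) (fun y => 𝔖.e i y b) x

/-- The Levi-Civita connection in the frame, `Γ_{abc} = g(∇_{e_a} e_b, e_c)`, by Koszul's formula
(the functions `g(e_a, e_b)` being constant). -/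
def leviCivita (x : M) (a b c : Fin 2 × Fin 2) : ℂ :=
  (1 / 2 : ℂ) * (g.formC x (𝔖.frameBracket i x a b) (𝔖.e i x c) -
    g.formC x (𝔖.frameBracket i x a c) (𝔖.e i x b) -
    g.formC x (𝔖.frameBracket i x b c) (𝔖.e i x a))

/-- The coefficients `γ_{aB}^C` of the Levi-Civita connection on `𝕊`, `∇_{e_a} o_B = γ_{aB}^C o_C`:
since `Γ_{aBB'CC'} = γ_{aBC} ε_{B'C'} + γ'_{aB'C'} ε_{BC}` with `γ`, `γ'` symmetric in the last two
indices, `γ_{aBC} = ½ ε^{B'C'} Γ_{aBB'CC'}`. -/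
def spinCoeff (x : M) (a : Fin 2 × Fin 2) (B C : Fin 2) : ℂ :=
  raise (fun D => (1 / 2 : ℂ) * ∑ B', ∑ D', eps B' D' * 𝔖.leviCivita i x a (B, B') (D, D')) C

/-- The coefficients `γ'_{aB'}^{C'}` of the Levi-Civita connection on `𝕊'`. -/
def spinCoeff' (x : M) (a : Fin 2 × Fin 2) (B' C' : Fin 2) : ℂ :=
  raise (fun D' => (1 / 2 : ℂ) * ∑ B, ∑ D, eps B D * 𝔖.leviCivita i x a (B, B') (D, D')) C'

/-- `∇_{AA'} ξ^B`. -/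
def nabla (ξ : M → Fin 2 → ℂ) (x : M) (a : Fin 2 × Fin 2) (B : Fin 2) : ℂ :=
  𝔖.der i x a (fun y => ξ y B) + ∑ C, 𝔖.spinCoeff i x a C B * ξ x C

/-- `∇_{AA'} ξ_B`, for a spinor with a lower index. -/
def nablaLow (ξ : M → Fin 2 → ℂ) (x : M) (a : Fin 2 × Fin 2) (B : Fin 2) : ℂ :=
  𝔖.der i x a (fun y => ξ y B) - ∑ C, 𝔖.spinCoeff i x a B C * ξ x C

/-- `∇_{AA'} ψ^{B'}`. -/
def nabla' (ψ : M → Fin 2 → ℂ) (x : M) (a : Fin 2 × Fin 2) (B' : Fin 2) : ℂ :=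
  𝔖.der i x a (fun y => ψ y B') + ∑ C', 𝔖.spinCoeff' i x a C' B' * ψ x C'

/-- The components `v^{AA'}` of a complex vector. -/
def vcomp {x : M} (v : CT x) (a : Fin 2 × Fin 2) : ℂ := (𝔖.e i x).repr v a

end SpinStructure

/-- The shear-free equation `β^A β^B ∇_{AA'} β_B = 0`. -/
def IsShearFree {𝔖 : SpinStructure g} (β : SpinorField 𝔖) : Prop :=
  ∀ i, ∀ x ∈ 𝔖.U i, ∀ A' : Fin 2,
    ∑ A, ∑ B, β.comp i x A * β.comp i x B *
      𝔖.nablaLow i (fun y => lower (β.comp i y)) x (A, A') B = 0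

/-! ### The gauge-covariant derivative -/

/-- A pair of spinor fields `α, β` with `φ = α_A β^A` nowhere zero, together with the conformal
weights `w₀, w₁` assigned to `α^A, β^A`. -/
structure Dyad (𝔖 : SpinStructure g) where
  α : SpinorField 𝔖
  β : SpinorField 𝔖
  w₀ : ℝ
  w₁ : ℝ
  φ_ne_zero : ∀ i, ∀ x ∈ 𝔖.U i, ∑ A, lower (α.comp i x) A * β.comp i x A ≠ 0

namespace Dyad

variable {𝔖 : SpinStructure g} (D : Dyad 𝔖) (i : 𝔖.ι)

/-- `φ = α_A β^A`. -/
def φ (x : M) : ℂ := ∑ A, lower (D.α.comp i x) A * D.β.comp i x A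

/-- `α_A`. -/
def αl (x : M) : Fin 2 → ℂ := lower (D.α.comp i x)

/-- `β_A`. -/
def βl (x : M) : Fin 2 → ℂ := lower (D.β.comp i x)

/-- `K^{AA'}_{BB'} = φ⁻¹ (α^A β_B + β^A α_B) δ^{A'}_{B'}`. -/
def K (x : M) (a b : Fin 2 × Fin 2) : ℂ :=
  (D.φ i x)⁻¹ * (D.α.comp i x a.1 * D.βl i x b.1 + D.β.comp i x a.1 * D.αl i x b.1) *
    kron a.2 b.2

/-- The projector `P^{AA'}_{BB'} = φ⁻¹ β^A α_B δ^{A'}_{B'}` as an endomorphism of `T_x M ⊗ ℂ`. -/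
def P (x : M) : CT x →ₗ[ℂ] CT x :=
  Matrix.toLin (𝔖.e i x) (𝔖.e i x) (Matrix.of fun a b : Fin 2 × Fin 2 =>
    (D.φ i x)⁻¹ * D.β.comp i x a.1 * D.αl i x b.1 * kron a.2 b.2)

/-- The fundamental 2-form `ω_{ab} = g_{cb} K^c_a`. -/
def fund (x : M) (a b : Fin 2 × Fin 2) : ℂ :=
  ∑ c : Fin 2 × Fin 2, eps c.1 b.1 * eps c.2 b.2 * D.K i x c a

/-- `ω^{ab} = g^{ac} g^{bd} ω_{cd}`. -/
def fundUp (x : M) (a b : Fin 2 × Fin 2) : ℂ :=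
  ∑ c : Fin 2 × Fin 2, ∑ d : Fin 2 × Fin 2,
    (eps a.1 c.1 * eps a.2 c.2) * (eps b.1 d.1 * eps b.2 d.2) * D.fund i x c d

/-- `ω([e_a, e_b], e_c)`. -/
def fundBracket (x : M) (a b c : Fin 2 × Fin 2) : ℂ :=
  ∑ d : Fin 2 × Fin 2, 𝔖.vcomp i (𝔖.frameBracket i x a b) d * D.fund i x d c

/-- `(dω)_{abc} = dω(e_a, e_b, e_c)`. -/
def dFund (x : M) (a b c : Fin 2 × Fin 2) : ℂ :=
  𝔖.der i x a (fun y => D.fund i y b c) + 𝔖.der i x b (fun y => D.fund i y c a) +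
    𝔖.der i x c (fun y => D.fund i y a b) -
    D.fundBracket i x a b c - D.fundBracket i x b c a - D.fundBracket i x c a b

/-- The Lee form `f_a = (1 / (2 (d - 2))) ω^{bc} (dω)_{abc}` of `K`, with `d = 4`. -/
def lee (x : M) (a : Fin 2 × Fin 2) : ℂ :=
  (1 / 4 : ℂ) * ∑ b : Fin 2 × Fin 2, ∑ c : Fin 2 × Fin 2, D.fundUp i x b c * D.dFund i x a b c

/-- `L_{AA'} = φ⁻¹ β_B ∇_{AA'} α^B + φ⁻¹ β_A f_{A'B} α^B - w₀ f_{AA'}`. -/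
def connL (x : M) (a : Fin 2 × Fin 2) : ℂ :=
  (D.φ i x)⁻¹ * (∑ B, D.βl i x B * 𝔖.nabla i (D.α.comp i) x a B) +
    (D.φ i x)⁻¹ * D.βl i x a.1 * (∑ B, D.lee i x (B, a.2) * D.α.comp i x B) -
    (D.w₀ : ℂ) * D.lee i x a

/-- `M_{AA'} = - φ⁻¹ α_B ∇_{AA'} β^B - φ⁻¹ α_A f_{A'B} β^B - w₁ f_{AA'}`. -/
def connM (x : M) (a : Fin 2 × Fin 2) : ℂ :=
  -((D.φ i x)⁻¹ * (∑ B, D.αl i x B * 𝔖.nabla i (D.β.comp i) x a B)) -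
    (D.φ i x)⁻¹ * D.αl i x a.1 * (∑ B, D.lee i x (B, a.2) * D.β.comp i x B) -
    (D.w₁ : ℂ) * D.lee i x a

/-- The gauge term `w f_{AA'} + r L_{AA'} + r' M_{AA'}` for a field of type `(r, r'; w)`. -/
def gaugeTerm (r r' w : ℝ) (x : M) (a : Fin 2 × Fin 2) : ℂ :=
  (w : ℂ) * D.lee i x a + (r : ℂ) * D.connL i x a + (r' : ℂ) * D.connM i x a

/-- `𝒞_{AA'} s` for a scalar field of type `(r, r'; w)`. -/
def covScalar (r r' w : ℝ) (s : M → ℂ) (x : M) (a : Fin 2 × Fin 2) : ℂ :=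
  𝔖.der i x a s + D.gaugeTerm i r r' w x a * s x

/-- The Weyl connection of the Lee form on a primed spinor field,
`∇_{AA'} ψ^{B'} + δ_{A'}^{B'} f_{AX'} ψ^{X'}`. -/
def weyl' (ψ : M → Fin 2 → ℂ) (x : M) (a : Fin 2 × Fin 2) (B' : Fin 2) : ℂ :=
  𝔖.nabla' i ψ x a B' + kron a.2 B' * ∑ X', D.lee i x (a.1, X') * ψ x X'

/-- `𝒞_{AA'} ψ^{B'}` for a primed spinor field of type `(r, r'; w)`. -/
def covPrimed (r r' w : ℝ) (ψ : M → Fin 2 → ℂ) (x : M) (a : Fin 2 × Fin 2) (B' : Fin 2) : ℂ :=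
  D.weyl' i ψ x a B' + D.gaugeTerm i r r' w x a * ψ x B'

/-- `𝒞_{A'} s = β^A 𝒞_{AA'} s`. -/
def CScalar (r r' w : ℝ) (s : M → ℂ) (x : M) (A' : Fin 2) : ℂ :=
  ∑ A, D.β.comp i x A * D.covScalar i r r' w s x (A, A')

/-- `𝒞_{A'} ψ^{B'} = β^A 𝒞_{AA'} ψ^{B'}`. -/
def CPrimed (r r' w : ℝ) (ψ : M → Fin 2 → ℂ) (x : M) (A' B' : Fin 2) : ℂ :=
  ∑ A, D.β.comp i x A * D.covPrimed i r r' w ψ x (A, A') B'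

end Dyad

/-! ### The bundle `L` -/

section EigenBundle

variable {𝔖 : SpinStructure.{u, v} g}

/-- The vector `β^A ν^{A'}` of `T_x M ⊗ ℂ`. -/
def spinVec (β : SpinorField 𝔖) (i : 𝔖.ι) (x : M) : (Fin 2 → ℂ) →ₗ[ℂ] CT x where
  toFun ν := ∑ A, ∑ A', (β.comp i x A * ν A') • 𝔖.e i x (A, A')
  map_add' := by
    intro ν ν'
    simp only [Pi.add_apply, mul_add, add_smul, Finset.sum_add_distrib]
  map_smul' := by
    intro a ν
    simp only [Pi.smul_apply, smul_eq_mul, RingHom.id_apply, Finset.smul_sum, smul_smul]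
    refine Finset.sum_congr rfl fun A _ => Finset.sum_congr rfl fun A' _ => ?_
    rw [mul_left_comm]

/-- The fibre `L_x = {β^A ν^{A'}}` of `L`. -/
def eigenspace (β : SpinorField 𝔖) (x : M) : Submodule ℂ (CT x) :=
  ⨅ (i : 𝔖.ι) (_ : x ∈ 𝔖.U i), LinearMap.range (spinVec β i x)

theorem spinVec_trans (β : SpinorField 𝔖) {i j : 𝔖.ι} {x : M} (hi : x ∈ 𝔖.U i) (hj : x ∈ 𝔖.U j)
    (ν : Fin 2 → ℂ) : spinVec β j x ν = spinVec β i x ((𝔖.Λ' i j x).mulVec ν) := by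
  have ht := β.transition i j x ⟨hi, hj⟩
  have he := 𝔖.e_transition i j x ⟨hi, hj⟩
  simp only [spinVec, LinearMap.coe_mk, AddHom.coe_mk, ht, he, Matrix.mulVec, dotProduct,
    Fin.sum_univ_two, smul_add, smul_smul]
  module

theorem range_spinVec_le (β : SpinorField 𝔖) {i j : 𝔖.ι} {x : M} (hi : x ∈ 𝔖.U i)
    (hj : x ∈ 𝔖.U j) : LinearMap.range (spinVec β j x) ≤ LinearMap.range (spinVec β i x) := by
  rintro _ ⟨ν, rfl⟩
  exact ⟨_, (spinVec_trans β hi hj ν).symm⟩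

theorem eigenspace_eq (β : SpinorField 𝔖) {i : 𝔖.ι} {x : M} (hi : x ∈ 𝔖.U i) :
    eigenspace β x = LinearMap.range (spinVec β i x) :=
  le_antisymm (iInf₂_le i hi) (le_iInf₂ fun _ hj => range_spinVec_le β hj hi)

theorem spinVec_injective (β : SpinorField 𝔖) {i : 𝔖.ι} {x : M} (h : β.comp i x ≠ 0) :
    Function.Injective (spinVec β i x) := by
  rw [← LinearMap.ker_eq_bot, LinearMap.ker_eq_bot']
  intro ν hν
  obtain ⟨A, hA⟩ := Function.ne_iff.mp h
  have hli := (𝔖.e i x).linearIndependent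
  rw [Fintype.linearIndependent_iff] at hli
  have key := hli (fun a => β.comp i x a.1 * ν a.2) (by
    rw [Fintype.sum_prod_type]
    exact hν)
  funext A'
  exact (mul_eq_zero.mp (key (A, A'))).resolve_left hA

/-- The isomorphism `ν^{A'} ↦ β^A ν^{A'}` onto the fibre of `L`. -/
def eigenEquiv (β : SpinorField 𝔖) {i : 𝔖.ι} {x : M} (hi : x ∈ 𝔖.U i) (h : β.comp i x ≠ 0) :
    (Fin 2 → ℂ) ≃ₗ[ℂ] eigenspace β x :=
  (LinearEquiv.ofInjective (spinVec β i x) (spinVec_injective β h)).trans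
    (LinearEquiv.ofEq _ _ (eigenspace_eq β hi).symm)

theorem coe_eigenEquiv (β : SpinorField 𝔖) {i : 𝔖.ι} {x : M} (hi : x ∈ 𝔖.U i)
    (h : β.comp i x ≠ 0) (ν : Fin 2 → ℂ) :
    ((eigenEquiv β hi h ν : eigenspace β x) : CT x) = spinVec β i x ν := rfl

/-- The vector bundle `L = {β^A ν^{A'}} ⊂ TM ⊗ ℂ`, with the local frames `β^A e_{AA'}`. -/
def eigenbundle (β : SpinorField 𝔖) (hβ : ∀ i, ∀ x ∈ 𝔖.U i, β.comp i x ≠ 0) :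
    SmoothCBundle M 2 where
  Fib x := eigenspace β x
  ι := 𝔖.ι
  U := 𝔖.U
  isOpen_U := 𝔖.isOpen_U
  cover := 𝔖.cover
  frame i x hx := (Pi.basisFun ℂ (Fin 2)).map (eigenEquiv β hx (hβ i x hx))
  transition i j := by
    refine ⟨fun l k x => 𝔖.Λ' i j x l k, fun l k => 𝔖.Λ'_smooth i j l k, ?_⟩
    intro x hi hj k
    apply Subtype.ext
    simp only [Module.Basis.map_apply, coe_eigenEquiv,
      ← map_smul, ← map_sum]
    rw [spinVec_trans β hi hj]
    congr 1
    funext l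
    simp [Matrix.mulVec, dotProduct, Pi.basisFun_apply, Finset.sum_apply, Pi.single_apply]

end EigenBundle

namespace Dyad

variable {𝔖 : SpinStructure g} (D : Dyad 𝔖)

theorem β_ne_zero (i : 𝔖.ι) (x : M) (hx : x ∈ 𝔖.U i) : D.β.comp i x ≠ 0 := by
  intro h
  exact D.φ_ne_zero i x hx (by simp [h])

/-- The bundle `L` of the dyad. -/
def L : SmoothCBundle M 2 := eigenbundle D.β D.β_ne_zero

/-- A vector of `L` as a complex tangent vector. -/
def toCT {x : M} : D.L.Fib x →ₗ[ℂ] CT x := (eigenspace D.β x).subtype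

theorem toCT_frame (i : 𝔖.ι) (x : M) (hx : x ∈ 𝔖.U i) (A' : Fin 2) :
    D.toCT (D.L.frame i x hx A') = spinVec D.β i x (Pi.single A' 1) := by
  have h : D.toCT (D.L.frame i x hx A') =
      spinVec D.β i x (Pi.basisFun ℂ (Fin 2) A') := by
    rfl
  rw [h, Pi.basisFun_apply]

/-- The vector field of a section of `L`. -/
def secVF (X : Γ D.L) (x : M) : CT x := D.toCT (X.1 x)

/-- The components `X^{AA'}` of a section of `L`. -/
def vecComp (i : 𝔖.ι) (X : Γ D.L) (x : M) (a : Fin 2 × Fin 2) : ℂ :=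
  𝔖.vcomp i (D.secVF X x) a

/-- The primed spinor `x^{A'} = φ⁻¹ α_B X^{BA'}` of `X^{AA'} = β^A x^{A'}`, of type
`(0, -1; -w₁)`. -/
def xi (i : 𝔖.ι) (X : Γ D.L) (x : M) (A' : Fin 2) : ℂ :=
  (D.φ i x)⁻¹ * ∑ B, D.αl i x B * D.vecComp i X x (B, A')

open Classical in
/-- The primed spinor `ω_{A'} = φ⁻¹ β^B ω_{BA'} = φ⁻¹ ω(β^B e_{BA'})` of the 1-form
`ω_{AA'} = α_A ω_{A'}`, of type `(-1, 0; -w₀ - 1)`. -/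
def omegaLow (i : 𝔖.ι) (η : BForm D.L 1) (x : M) (A' : Fin 2) : ℂ :=
  if hx : x ∈ 𝔖.U i then (D.φ i x)⁻¹ * η.toFun x (fun _ => D.L.frame i x hx A') else 0

/-- The primed spinor `ω^{A'} = ε^{A'B'} ω_{B'}`, of type `(-1, 0; -w₀ - 2)`. -/
def omegaUp (i : 𝔖.ι) (η : BForm D.L 1) (x : M) : Fin 2 → ℂ := raise (D.omegaLow i η x)

/-- The divergence `𝒞_{C'} ω^{C'}`. -/
def divOmega (i : 𝔖.ι) (η : BForm D.L 1) (x : M) : ℂ :=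
  ∑ C', D.CPrimed i (-1) 0 (-D.w₀ - 2) (D.omegaUp i η) x C' C'

/-- The right-hand side `β^A (x^{B'} 𝒞_{B'} y^{A'} - y^{B'} 𝒞_{B'} x^{A'})` of the bracket. -/
def bracketRHS (i : 𝔖.ι) (X Y : Γ D.L) (x : M) (A A' : Fin 2) : ℂ :=
  D.β.comp i x A *
    ((∑ B', D.xi i X x B' * D.CPrimed i 0 (-1) (-D.w₁) (D.xi i Y) x B' A') -
      ∑ B', D.xi i Y x B' * D.CPrimed i 0 (-1) (-D.w₁) (D.xi i X) x B' A')

/-- The components `φ⁻¹ α_A 𝒞_{A'} f` of `d^L f`. -/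
def dFunRHS (i : 𝔖.ι) (f : M → ℂ) (x : M) (A A' : Fin 2) : ℂ :=
  (D.φ i x)⁻¹ * D.αl i x A * D.CScalar i 0 0 0 f x A'

/-- The components `φ⁻¹ (𝒞_{C'} ω^{C'}) α_A α_B ε_{A'B'}` of `d^L ω`. -/
def dFormRHS (i : 𝔖.ι) (η : BForm D.L 1) (x : M) (A A' B B' : Fin 2) : ℂ :=
  (D.φ i x)⁻¹ * D.divOmega i η x * D.αl i x A * D.αl i x B * eps A' B'

/-- The components `α_A [x_{A'} (𝒞_{B'} ω^{B'}) + 𝒞_{A'} (x^{B'} ω_{B'})]` of the generalized Lie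
derivative, where `x^{B'} ω_{B'}` is a scalar of type `(-1, -1; -w₀ - w₁ - 1)`. -/
def lieRHS (i : 𝔖.ι) (X : Γ D.L) (η : BForm D.L 1) (x : M) (A A' : Fin 2) : ℂ :=
  D.αl i x A *
    (lower (D.xi i X x) A' * D.divOmega i η x +
      D.CScalar i (-1) (-1) (-D.w₀ - D.w₁ - 1)
        (fun y => ∑ B', D.xi i X y B' * D.omegaLow i η y B') x A')

end Dyad

end Conformal

end ShearFree

/-!
The anchor `P` restricts to the identity on `L`, so it is injective there, and the bracket of the
Lie algebroid can only be the complexified Lie bracket `lieC` of vector fields restricted to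
sections of `L`. Skewness, the Leibniz rule and the Jacobi identity are then inherited from vector
fields (`lieC_swap`, `lieC_smul_right`, `lieC_jacobi`), and the one thing to prove is that `L` is
involutive. This is what the shear-free equation provides: it says that `β^A ∇_{AA'} β^C` is a
multiple `λ_{A'} β^C` of `β^C` (`Dyad.nabla_β_of_isShearFree`). Since the spin connections are
torsion-free (`vcomp_frameBracket`), the local frame `E_{A'} = β^A e_{AA'}` of `L` satisfies
`[E_{A'}, E_{B'}] = c_{A'B'}^{C'} E_{C'}` with `c` expressed through `λ` and the primed connection
coefficients (`Dyad.lieC_lframe`).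

The formulas of the theorem follow by contracting the gauge-covariant derivative with `β^A`.
Along `L` the gauge term of type `(r, r'; w)` is
`(w - r w₀ - r' (w₁ + 1)) F_{A'} + r μ_{A'} - r' λ_{A'}`, where `F_{A'} = β^A f_{AA'}` and
`μ_{A'} = φ⁻¹ β_C β^A ∇_{AA'} α^C` (`Dyad.sum_gaugeTerm`). For the weights that occur in the theorem
the Lee form drops out of every expression, against the trace term of the Weyl connection where
there is one, so that nothing about `f` beyond its being some field of covectors is needed. What
remains are the expressions for the bracket and for `d^L` in the local frame
`E_{A'}`, once `E_{A'} φ = φ (λ_{A'} - μ_{A'})` (`Dyad.dirDeriv_φ`) is used to pass from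
the components `ω(E_{A'}) = φ ω_{A'}` to `ω_{A'}`.

In degree `k ≥ 3` there are no nonzero forms, the rank of `L` being 2. In degree 2 a form is
`h (x^0 y^1 - x^1 y^0)` in the local frame, and its exterior derivative is an alternating function
of three vectors of a two-dimensional space; it is computed to be zero in `Dyad.extD_two_form`.
-/

namespace ShearFree

/-! ### Calculus of complex vector fields -/

section Calculus

variable {M : Type u} [TopologicalSpace M] [ChartedSpace E4 M]

theorem reT_tmul {x : M} (c : ℂ) (v : TangentSpace (𝓡 4) x) : reT (c ⊗ₜ[ℝ] v) = c.re • v := by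
  simp [reT]

theorem imT_tmul {x : M} (c : ℂ) (v : TangentSpace (𝓡 4) x) : imT (c ⊗ₜ[ℝ] v) = c.im • v := by
  simp [imT]

theorem reT_add {x : M} (v w : CT x) : reT (v + w) = reT v + reT w := by
  simp only [reT, map_add]

theorem imT_add {x : M} (v w : CT x) : imT (v + w) = imT v + imT w := by
  simp only [imT, map_add]

theorem reT_zero {x : M} : reT (0 : CT x) = 0 := by simp only [reT, map_zero]

theorem imT_zero {x : M} : imT (0 : CT x) = 0 := by simp only [imT, map_zero]

theorem reT_smul {x : M} (c : ℂ) (v : CT x) : reT (c • v) = c.re • reT v - c.im • imT v := by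
  induction v using TensorProduct.induction_on with
  | zero => simp only [smul_zero, reT_zero, imT_zero, sub_self]
  | tmul a v =>
    simp only [TensorProduct.smul_tmul', reT_tmul, imT_tmul, smul_eq_mul, Complex.mul_re]
    module
  | add v w hv hw =>
    simp only [smul_add, reT_add, imT_add, hv, hw]
    module

theorem imT_smul {x : M} (c : ℂ) (v : CT x) : imT (c • v) = c.re • imT v + c.im • reT v := by
  induction v using TensorProduct.induction_on with
  | zero => simp only [smul_zero, reT_zero, imT_zero, add_zero]
  | tmul a v =>
    simp only [TensorProduct.smul_tmul', reT_tmul, imT_tmul, smul_eq_mul, Complex.mul_im]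
    module
  | add v w hv hw =>
    simp only [smul_add, reT_add, imT_add, hv, hw]
    module

theorem reT_mkT {x : M} (v w : TangentSpace (𝓡 4) x) : reT (mkT v w) = v := by
  simp only [mkT, reT_add, reT_tmul, Complex.one_re, Complex.I_re]
  module

theorem imT_mkT {x : M} (v w : TangentSpace (𝓡 4) x) : imT (mkT v w) = w := by
  simp only [mkT, imT_add, imT_tmul, Complex.one_im, Complex.I_im]
  module

theorem mkT_reT_imT {x : M} (v : CT x) : mkT (reT v) (imT v) = v := by
  induction v using TensorProduct.induction_on with
  | zero => simp only [reT_zero, imT_zero, mkT, TensorProduct.tmul_zero, add_zero]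
  | tmul a v =>
    simp only [reT_tmul, imT_tmul, mkT, ← TensorProduct.smul_tmul, ← TensorProduct.add_tmul]
    congr 1
    apply Complex.ext <;> simp
  | add v w hv hw =>
    conv_rhs => rw [← hv, ← hw]
    simp only [reT_add, imT_add, mkT, TensorProduct.tmul_add]
    abel

theorem ct_ext {x : M} {v w : CT x} (hr : reT v = reT w) (hi : imT v = imT w) : v = w := by
  rw [← mkT_reT_imT v, ← mkT_reT_imT w, hr, hi]

/-- Smoothness at a point of a complex-valued function. -/
abbrev SmoothAt (f : M → ℂ) (x : M) : Prop := ContMDiffAt (𝓡 4) 𝓘(ℝ, ℂ) ∞ f x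

theorem SmoothAt.mul {f h : M → ℂ} {x : M} (hf : SmoothAt f x) (hh : SmoothAt h x) :
    SmoothAt (fun y => f y * h y) x :=
  (contDiff_mul (𝕜 := ℝ) (𝔸 := ℂ) (n := ∞)).contMDiff.contMDiffAt.comp x (hf.prodMk_space hh)

theorem SmoothAt.inv {f : M → ℂ} {x : M} (hf : SmoothAt f x) (h : f x ≠ 0) :
    SmoothAt (fun y => (f y)⁻¹) x :=
  ((contDiffAt_inv ℂ h).restrict_scalars ℝ).contMDiffAt.comp x hf

theorem SmoothAt.mdiff {f : M → ℂ} {x : M} (hf : SmoothAt f x) :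
    MDifferentiableAt (𝓡 4) 𝓘(ℝ, ℂ) f x := hf.mdifferentiableAt (by simp)

/-- `mvfderiv` is `mfderiv` with values in `ℂ` itself rather than in its tangent space, which makes the
linear algebra of the target available. -/
theorem dirDeriv_eq (f : M → ℂ) (x : M) (v : CT x) :
    dirDeriv f x v =
      mvfderiv (𝓡 4) f x (reT v) + Complex.I * mvfderiv (𝓡 4) f x (imT v) := rfl

theorem dirDeriv_add_vec (f : M → ℂ) (x : M) (v w : CT x) :
    dirDeriv f x (v + w) = dirDeriv f x v + dirDeriv f x w := by
  simp only [dirDeriv_eq, reT_add, imT_add, map_add]; ring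

theorem dirDeriv_smul_vec (f : M → ℂ) (x : M) (c : ℂ) (v : CT x) :
    dirDeriv f x (c • v) = c * dirDeriv f x v := by
  simp only [dirDeriv_eq, reT_smul, imT_smul, map_add, map_sub, map_smul, Complex.real_smul]
  conv_rhs => rw [← Complex.re_add_im c]
  linear_combination (-(c.im : ℂ) * mvfderiv (𝓡 4) f x (imT v)) * Complex.I_sq

theorem dirDeriv_congr {f h : M → ℂ} {x : M} (e : f =ᶠ[nhds x] h) (v : CT x) :
    dirDeriv f x v = dirDeriv h x v := by
  simp only [dirDeriv, e.mfderiv_eq]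

theorem dirDeriv_const (c : ℂ) (x : M) (v : CT x) : dirDeriv (fun _ => c) x v = 0 := by
  simp [dirDeriv_eq, mvfderiv_const]

theorem dirDeriv_add {f h : M → ℂ} {x : M} (hf : SmoothAt f x) (hh : SmoothAt h x) (v : CT x) :
    dirDeriv (fun y => f y + h y) x v = dirDeriv f x v + dirDeriv h x v := by
  simp only [dirDeriv_eq, mvfderiv_fun_add hf.mdiff hh.mdiff, add_apply]
  ring

theorem dirDeriv_mul {f h : M → ℂ} {x : M} (hf : SmoothAt f x) (hh : SmoothAt h x) (v : CT x) :
    dirDeriv (fun y => f y * h y) x v = f x * dirDeriv h x v + h x * dirDeriv f x v := by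
  have e (w : TangentSpace (𝓡 4) x) : mvfderiv (𝓡 4) (fun y => f y * h y) x w =
      f x * mvfderiv (𝓡 4) h x w + h x * mvfderiv (𝓡 4) f x w :=
    DFunLike.congr_fun (hf.mdiff.hasMFDerivAt.mul hh.mdiff.hasMFDerivAt).mfderiv w
  simp only [dirDeriv_eq, e]
  ring

theorem dirDeriv_neg (f : M → ℂ) (x : M) (hf : SmoothAt f x) (v : CT x) :
    dirDeriv (fun y => -f y) x v = -dirDeriv f x v := by
  have e : (fun y => -f y) = fun y => (-1) * f y := by funext y; ring
  rw [e, dirDeriv_mul contMDiffAt_const hf, dirDeriv_const]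
  ring

theorem mvfderiv_re {f : M → ℂ} {x : M} (hf : SmoothAt f x) (v : TangentSpace (𝓡 4) x) :
    mvfderiv (𝓡 4) (fun y => (f y).re) x v = (mvfderiv (𝓡 4) f x v).re := by
  have := (Complex.reCLM.hasFDerivAt (x := f x)).hasMFDerivAt.comp x hf.mdiff.hasMFDerivAt
  exact DFunLike.congr_fun this.mfderiv v

theorem mvfderiv_im {f : M → ℂ} {x : M} (hf : SmoothAt f x) (v : TangentSpace (𝓡 4) x) :
    mvfderiv (𝓡 4) (fun y => (f y).im) x v = (mvfderiv (𝓡 4) f x v).im := by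
  have := (Complex.imCLM.hasFDerivAt (x := f x)).hasMFDerivAt.comp x hf.mdiff.hasMFDerivAt
  exact DFunLike.congr_fun this.mfderiv v

theorem SmoothAt.re {f : M → ℂ} {x : M} (hf : SmoothAt f x) :
    ContMDiffAt (𝓡 4) 𝓘(ℝ, ℝ) ∞ (fun y => (f y).re) x :=
  Complex.reCLM.contMDiff.contMDiffAt.comp x hf

theorem SmoothAt.im {f : M → ℂ} {x : M} (hf : SmoothAt f x) :
    ContMDiffAt (𝓡 4) 𝓘(ℝ, ℝ) ∞ (fun y => (f y).im) x :=
  Complex.imCLM.contMDiff.contMDiffAt.comp x hf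

theorem SmoothAt.ofReal {f : M → ℝ} {x : M} (hf : ContMDiffAt (𝓡 4) 𝓘(ℝ, ℝ) ∞ f x) :
    SmoothAt (fun y => (f y : ℂ)) x :=
  Complex.ofRealCLM.contMDiff.contMDiffAt.comp x hf

/-- The bracket at a point depends only on the germs of the fields. -/
theorem lieC_congr {X X' Y Y' : ∀ x : M, CT x} {x : M} (hX : ∀ᶠ y in nhds x, X y = X' y)
    (hY : ∀ᶠ y in nhds x, Y y = Y' y) : lieC X Y x = lieC X' Y' x := by
  have h1 : ∀ᶠ y in nhds x, reT (X y) = reT (X' y) :=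
    hX.mono fun y h => congrArg reT h
  have h2 : ∀ᶠ y in nhds x, imT (X y) = imT (X' y) :=
    hX.mono fun y h => congrArg imT h
  have h3 : ∀ᶠ y in nhds x, reT (Y y) = reT (Y' y) :=
    hY.mono fun y h => congrArg reT h
  have h4 : ∀ᶠ y in nhds x, imT (Y y) = imT (Y' y) :=
    hY.mono fun y h => congrArg imT h
  have e {V V' W W' : ∀ x : M, TangentSpace (𝓡 4) x} (hV : ∀ᶠ y in nhds x, V y = V' y)
      (hW : ∀ᶠ y in nhds x, W y = W' y) : VectorField.mlieBracket (𝓡 4) V W x =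
        VectorField.mlieBracket (𝓡 4) V' W' x :=
    Filter.EventuallyEq.mlieBracket_vectorField_eq hV hW
  simp only [lieC]
  rw [e h1 h3, e h1 h4, e h2 h3, e h2 h4]

theorem lieC_swap (X Y : ∀ x : M, CT x) (x : M) : lieC X Y x = -lieC Y X x := by
  rw [← neg_one_smul ℂ]
  apply ct_ext <;>
    simp only [reT_smul, imT_smul, lieC, reT_mkT, imT_mkT, Complex.neg_re, Complex.neg_im,
      Complex.one_re, Complex.one_im]
  · rw [VectorField.mlieBracket_swap_apply (V := fun y => reT (X y)),
      VectorField.mlieBracket_swap_apply (V := fun y => imT (X y))]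
    module
  · rw [VectorField.mlieBracket_swap_apply (V := fun y => reT (X y)),
      VectorField.mlieBracket_swap_apply (V := fun y => imT (X y))]
    module

end Calculus

/-! ### The complexified Lie bracket on smooth fields -/

section Bracket

variable {M : Type u} [TopologicalSpace M] [ChartedSpace E4 M] [IsManifold (𝓡 4) ∞ M]

/-- Smoothness at a point of a real vector field. -/
abbrev RVFSmoothAt (X : ∀ x : M, TangentSpace (𝓡 4) x) (x : M) : Prop :=
  ContMDiffAt (𝓡 4) (𝓡 4).tangent ∞ (fun x => (⟨x, X x⟩ : TangentBundle (𝓡 4) M)) x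

/-- Smoothness at a point of a complex vector field. -/
def VFSmoothAt (X : ∀ x : M, CT x) (x : M) : Prop :=
  RVFSmoothAt (fun y => reT (X y)) x ∧ RVFSmoothAt (fun y => imT (X y)) x

/-- The regularity hypotheses of Mathlib's Lie bracket are phrased with `minSmoothness`, which over `ℝ`
is the given order. -/
theorem isManifold_minSmoothness (M : Type u) [TopologicalSpace M] [ChartedSpace E4 M]
    [IsManifold (𝓡 4) ∞ M] (k : ℕ) : IsManifold (𝓡 4) (minSmoothness ℝ k) M :=
  IsManifold.of_le (n := ∞) (by simp; exact_mod_cast le_top)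

theorem RVFSmoothAt.mdiff {X : ∀ x : M, TangentSpace (𝓡 4) x} {x : M} (h : RVFSmoothAt X x) :
    MDifferentiableAt (𝓡 4) (𝓡 4).tangent (fun x => (⟨x, X x⟩ : TangentBundle (𝓡 4) M)) x :=
  h.mdifferentiableAt (by simp)

theorem RVFSmoothAt.add {X Y : ∀ x : M, TangentSpace (𝓡 4) x} {x : M}
    (hX : RVFSmoothAt X x) (hY : RVFSmoothAt Y x) : RVFSmoothAt (X + Y) x :=
  ContMDiffAt.add_section hX hY

theorem RVFSmoothAt.sub {X Y : ∀ x : M, TangentSpace (𝓡 4) x} {x : M}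
    (hX : RVFSmoothAt X x) (hY : RVFSmoothAt Y x) : RVFSmoothAt (X - Y) x :=
  ContMDiffAt.sub_section hX hY

theorem RVFSmoothAt.smul {f : M → ℝ} {X : ∀ x : M, TangentSpace (𝓡 4) x} {x : M}
    (hf : ContMDiffAt (𝓡 4) 𝓘(ℝ, ℝ) ∞ f x) (hX : RVFSmoothAt X x) : RVFSmoothAt (f • X) x :=
  ContMDiffAt.smul_section hf hX

theorem RVFSmoothAt.bracket {X Y : ∀ x : M, TangentSpace (𝓡 4) x} {x : M}
    (hX : RVFSmoothAt X x) (hY : RVFSmoothAt Y x) :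
    RVFSmoothAt (VectorField.mlieBracket (𝓡 4) X Y) x :=
  haveI : IsManifold (𝓡 4) (minSmoothness ℝ 2) M := isManifold_minSmoothness M 2
  haveI : IsManifold (𝓡 4) (((⊤ : ℕ∞) : WithTop ℕ∞) + 1) M := by simpa
  ContMDiffAt.mlieBracket_vectorField (n := ⊤) (m := ⊤) hX hY (by simp)

theorem mlieBracket_sub_right {X Y V : ∀ x : M, TangentSpace (𝓡 4) x} {x : M}
    (hX : RVFSmoothAt X x) (hY : RVFSmoothAt Y x) :
    VectorField.mlieBracket (𝓡 4) V (X - Y) x =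
      VectorField.mlieBracket (𝓡 4) V X x - VectorField.mlieBracket (𝓡 4) V Y x := by
  have h : X - Y = X + (-1 : ℝ) • Y := by rw [neg_one_smul, sub_eq_add_neg]
  have hY' : RVFSmoothAt ((-1 : ℝ) • Y) x := ContMDiffAt.const_smul_section hY
  rw [h, VectorField.mlieBracket_add_right hX.mdiff hY'.mdiff,
    VectorField.mlieBracket_const_smul_right hY.mdiff, neg_one_smul, sub_eq_add_neg]

theorem VFSmoothAt.add {X Y : ∀ x : M, CT x} {x : M} (hX : VFSmoothAt X x)
    (hY : VFSmoothAt Y x) : VFSmoothAt (fun y => X y + Y y) x := by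
  refine ⟨?_, ?_⟩
  · simp only [reT_add]; exact hX.1.add hY.1
  · simp only [imT_add]; exact hX.2.add hY.2

theorem VFSmoothAt.smul {f : M → ℂ} {X : ∀ x : M, CT x} {x : M} (hf : SmoothAt f x)
    (hX : VFSmoothAt X x) : VFSmoothAt (fun y => f y • X y) x := by
  refine ⟨?_, ?_⟩
  · simp only [reT_smul]; exact (hX.1.smul hf.re).sub (hX.2.smul hf.im)
  · simp only [imT_smul]; exact (hX.2.smul hf.re).add (hX.1.smul hf.im)

theorem VFSmoothAt.lieC {X Y : ∀ x : M, CT x} {x : M} (hX : VFSmoothAt X x)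
    (hY : VFSmoothAt Y x) : VFSmoothAt (lieC X Y) x := by
  refine ⟨?_, ?_⟩
  · simp only [ShearFree.lieC, reT_mkT]
    exact (hX.1.bracket hY.1).sub (hX.2.bracket hY.2)
  · simp only [ShearFree.lieC, imT_mkT]
    exact (hX.1.bracket hY.2).add (hX.2.bracket hY.1)

theorem lieC_add_right {X Y Z : ∀ x : M, CT x} {x : M} (hY : VFSmoothAt Y x)
    (hZ : VFSmoothAt Z x) :
    lieC X (fun y => Y y + Z y) x = lieC X Y x + lieC X Z x := by
  have e (V : ∀ x : M, TangentSpace (𝓡 4) x) := VectorField.mlieBracket_add_right (V := V)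
    hY.1.mdiff hZ.1.mdiff
  have e' (V : ∀ x : M, TangentSpace (𝓡 4) x) := VectorField.mlieBracket_add_right (V := V)
    hY.2.mdiff hZ.2.mdiff
  simp only [Pi.add_def] at e e'
  apply ct_ext <;> simp only [reT_add, imT_add, lieC, reT_mkT, imT_mkT, e, e'] <;> module

/-- The Leibniz rule of the complexified Lie bracket in its second argument. -/
theorem lieC_smul_right {f : M → ℂ} {X Y : ∀ x : M, CT x} {x : M} (hf : SmoothAt f x)
    (hY : VFSmoothAt Y x) :
    lieC X (fun y => f y • Y y) x = dirDeriv f x (X x) • Y x + f x • lieC X Y x := by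
  have e1 (V : ∀ x : M, TangentSpace (𝓡 4) x) := VectorField.mlieBracket_smul_right (V := V)
    (hf.re.mdifferentiableAt (by simp)) hY.1.mdiff
  have e2 (V : ∀ x : M, TangentSpace (𝓡 4) x) := VectorField.mlieBracket_smul_right (V := V)
    (hf.re.mdifferentiableAt (by simp)) hY.2.mdiff
  have e3 (V : ∀ x : M, TangentSpace (𝓡 4) x) := VectorField.mlieBracket_smul_right (V := V)
    (hf.im.mdifferentiableAt (by simp)) hY.1.mdiff
  have e4 (V : ∀ x : M, TangentSpace (𝓡 4) x) := VectorField.mlieBracket_smul_right (V := V)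
    (hf.im.mdifferentiableAt (by simp)) hY.2.mdiff
  have a (V : ∀ x : M, TangentSpace (𝓡 4) x) := mlieBracket_sub_right (V := V)
    (hY.1.smul hf.re) (hY.2.smul hf.im)
  have a' (V : ∀ x : M, TangentSpace (𝓡 4) x) := VectorField.mlieBracket_add_right (V := V)
    (hY.2.smul hf.re).mdiff (hY.1.smul hf.im).mdiff
  have r (V : TangentSpace (𝓡 4) x) := mvfderiv_re hf V
  have i (V : TangentSpace (𝓡 4) x) := mvfderiv_im hf V
  simp only [e1, e2, e3, e4, r, i] at a a'
  simp only [Pi.sub_def, Pi.add_def, Pi.smul_def'] at a a'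
  apply ct_ext <;> simp only [reT_add, imT_add, reT_smul, imT_smul, lieC, reT_mkT, imT_mkT, a, a',
    dirDeriv_eq, Complex.add_re, Complex.add_im, Complex.mul_re, Complex.mul_im, Complex.I_re,
    Complex.I_im] <;> module

theorem lieC_add_left {X Y Z : ∀ x : M, CT x} {x : M} (hX : VFSmoothAt X x)
    (hY : VFSmoothAt Y x) :
    lieC (fun y => X y + Y y) Z x = lieC X Z x + lieC Y Z x := by
  rw [lieC_swap, lieC_add_right hX hY, lieC_swap X Z, lieC_swap Y Z]
  abel

theorem lieC_smul_left {f : M → ℂ} {X Y : ∀ x : M, CT x} {x : M} (hf : SmoothAt f x)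
    (hX : VFSmoothAt X x) :
    lieC (fun y => f y • X y) Y x = -(dirDeriv f x (Y x) • X x) + f x • lieC X Y x := by
  rw [lieC_swap, lieC_smul_right hf hX, lieC_swap X Y]
  module

/-- The Jacobi identity of the complexified Lie bracket. -/
theorem lieC_jacobi {X Y Z : ∀ x : M, CT x} (hX : ∀ x, VFSmoothAt X x)
    (hY : ∀ x, VFSmoothAt Y x) (hZ : ∀ x, VFSmoothAt Z x) (x : M) :
    lieC X (lieC Y Z) x + lieC Z (lieC X Y) x + lieC Y (lieC Z X) x = 0 := by
  have : IsManifold (𝓡 4) (minSmoothness ℝ 3) M := isManifold_minSmoothness M 3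
  have jac {U V W : ∀ x : M, TangentSpace (𝓡 4) x} (hU : RVFSmoothAt U x) (hV : RVFSmoothAt V x)
      (hW : RVFSmoothAt W x) :
      VectorField.mlieBracket (𝓡 4) U (VectorField.mlieBracket (𝓡 4) V W) x +
        VectorField.mlieBracket (𝓡 4) W (VectorField.mlieBracket (𝓡 4) U V) x +
        VectorField.mlieBracket (𝓡 4) V (VectorField.mlieBracket (𝓡 4) W U) x = 0 := by
    have le : minSmoothness ℝ 2 ≤ (∞ : WithTop ℕ∞) := by
      rw [minSmoothness_of_isRCLikeNormedField]; exact WithTop.coe_le_coe.2 le_top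
    rw [VectorField.leibniz_identity_mlieBracket_apply (hU.of_le le) (hV.of_le le) (hW.of_le le),
      VectorField.mlieBracket_swap_apply (V := W),
      VectorField.mlieBracket_swap (V := W) (W := U)]
    have : VectorField.mlieBracket (𝓡 4) V (-VectorField.mlieBracket (𝓡 4) U W) x =
        -VectorField.mlieBracket (𝓡 4) V (VectorField.mlieBracket (𝓡 4) U W) x := by
      have h := VectorField.mlieBracket_const_smul_right (c := (-1 : ℝ)) (V := V)
        (hU.bracket hW).mdiff
      simpa only [neg_one_smul] using h
    rw [this]
    abel
  have add {U V W : ∀ x : M, TangentSpace (𝓡 4) x} (hV : RVFSmoothAt V x) (hW : RVFSmoothAt W x) :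
      VectorField.mlieBracket (𝓡 4) U (fun y => V y + W y) x =
        VectorField.mlieBracket (𝓡 4) U V x + VectorField.mlieBracket (𝓡 4) U W x :=
    VectorField.mlieBracket_add_right hV.mdiff hW.mdiff
  have sub {U V W : ∀ x : M, TangentSpace (𝓡 4) x} (hV : RVFSmoothAt V x) (hW : RVFSmoothAt W x) :
      VectorField.mlieBracket (𝓡 4) U (fun y => V y - W y) x =
        VectorField.mlieBracket (𝓡 4) U V x - VectorField.mlieBracket (𝓡 4) U W x :=
    mlieBracket_sub_right hV hW
  have X1 := (hX x).1
  have X2 := (hX x).2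
  have Y1 := (hY x).1
  have Y2 := (hY x).2
  have Z1 := (hZ x).1
  have Z2 := (hZ x).2
  have j111 := jac X1 Y1 Z1
  have j112 := jac X1 Y1 Z2
  have j121 := jac X1 Y2 Z1
  have j122 := jac X1 Y2 Z2
  have j211 := jac X2 Y1 Z1
  have j212 := jac X2 Y1 Z2
  have j221 := jac X2 Y2 Z1
  have j222 := jac X2 Y2 Z2
  let B := VectorField.mlieBracket (𝓡 4) (M := M)
  -- Each double bracket splits into eight real ones, to which the real Jacobi identity applies.
  have expand {U V W : ∀ x : M, CT x} (hV : VFSmoothAt V x) (hW : VFSmoothAt W x) :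
      lieC U (lieC V W) x = mkT
        (B (fun y => reT (U y)) (B (fun y => reT (V y)) (fun y => reT (W y))) x -
          B (fun y => reT (U y)) (B (fun y => imT (V y)) (fun y => imT (W y))) x -
          (B (fun y => imT (U y)) (B (fun y => reT (V y)) (fun y => imT (W y))) x +
            B (fun y => imT (U y)) (B (fun y => imT (V y)) (fun y => reT (W y))) x))
        (B (fun y => reT (U y)) (B (fun y => reT (V y)) (fun y => imT (W y))) x +
            B (fun y => reT (U y)) (B (fun y => imT (V y)) (fun y => reT (W y))) x +
          (B (fun y => imT (U y)) (B (fun y => reT (V y)) (fun y => reT (W y))) x -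
            B (fun y => imT (U y)) (B (fun y => imT (V y)) (fun y => imT (W y))) x)) := by
    rw [lieC]
    simp only [lieC, reT_mkT, imT_mkT]
    rw [sub (hV.1.bracket hW.1) (hV.2.bracket hW.2), sub (hV.1.bracket hW.1) (hV.2.bracket hW.2),
      add (hV.1.bracket hW.2) (hV.2.bracket hW.1), add (hV.1.bracket hW.2) (hV.2.bracket hW.1)]
  rw [expand (hY x) (hZ x), expand (hX x) (hY x), expand (hZ x) (hX x)]
  apply ct_ext <;> simp only [reT_add, imT_add, reT_mkT, imT_mkT, reT_zero, imT_zero]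
  · linear_combination (norm := module) j111 - j122 - j212 - j221
  · linear_combination (norm := module) j112 + j121 + j211 - j222

end Bracket

/-! ### Components of complex vectors in a spin frame -/

section MetricComponents

variable {M : Type u} [TopologicalSpace M] [ChartedSpace E4 M] [IsManifold (𝓡 4) ∞ M]

theorem formC_eq (g : Metric M) (x : M) (v w : CT x) :
    g.formC x v w =
      ((g.form x (reT v) (reT w) - g.form x (imT v) (imT w) : ℝ) : ℂ) +
        Complex.I * ((g.form x (reT v) (imT w) + g.form x (imT v) (reT w) : ℝ) : ℂ) := by
  conv_lhs => rw [← mkT_reT_imT v, ← mkT_reT_imT w]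
  simp only [mkT, map_add, LinearMap.add_apply, Metric.formC, LinearMap.BilinForm.baseChange_tmul]
  simp
  ring

theorem Metric.form_smoothAt (g : Metric M) {x : M} {X Y : ∀ x : M, TangentSpace (𝓡 4) x}
    (hX : RVFSmoothAt X x) (hY : RVFSmoothAt Y x) :
    ContMDiffAt (𝓡 4) 𝓘(ℝ, ℝ) ∞ (fun y => g.form y (X y) (Y y)) x := by
  have h := ContMDiffAt.clm_bundle_apply₂ (F₁ := E4) (F₂ := E4) (F₃ := ℝ)
    (E₁ := fun x : M => TangentSpace (𝓡 4) x) (E₂ := fun x : M => TangentSpace (𝓡 4) x)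
    (E₃ := Bundle.Trivial M ℝ) (b := fun y => y) (g.smooth.contMDiffAt (x := x)) hX hY
  simp only [Bundle.contMDiffAt_totalSpace] at h
  exact h.2

theorem Metric.formC_smoothAt (g : Metric M) {x : M} {X Y : ∀ x : M, CT x}
    (hX : VFSmoothAt X x) (hY : VFSmoothAt Y x) :
    SmoothAt (fun y => g.formC y (X y) (Y y)) x := by
  simp only [formC_eq]
  exact (SmoothAt.ofReal ((g.form_smoothAt hX.1 hY.1).sub (g.form_smoothAt hX.2 hY.2))).add
    (SmoothAt.mul contMDiffAt_const
      (SmoothAt.ofReal ((g.form_smoothAt hX.1 hY.2).add (g.form_smoothAt hX.2 hY.1))))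

variable {g : Metric M} {𝔖 : SpinStructure.{u, v} g} {i : 𝔖.ι}

theorem SpinStructure.frame_smoothAt {x : M} (hx : x ∈ 𝔖.U i) (a : Fin 2 × Fin 2) :
    VFSmoothAt (fun y => 𝔖.e i y a) x :=
  ⟨(𝔖.e_smooth i a).1.contMDiffAt ((𝔖.isOpen_U i).mem_nhds hx),
    (𝔖.e_smooth i a).2.contMDiffAt ((𝔖.isOpen_U i).mem_nhds hx)⟩

theorem SpinStructure.sum_vcomp {x : M} (v : CT x) : ∑ a, 𝔖.vcomp i v a • 𝔖.e i x a = v :=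
  (𝔖.e i x).sum_repr v

/-- The components of a vector are recovered from its products with the frame, by raising indices.
This is what makes them smooth. -/
theorem SpinStructure.vcomp_eq_formC {x : M} (hx : x ∈ 𝔖.U i) (v : CT x) (a : Fin 2 × Fin 2) :
    𝔖.vcomp i v a = ∑ b : Fin 2 × Fin 2, eps a.1 b.1 * eps a.2 b.2 * g.formC x v (𝔖.e i x b) := by
  -- Lower the index with the metric; the final computation is `ε^{AC} ε_{BC} = δ^A_B`.
  have key (b : Fin 2 × Fin 2) : g.formC x v (𝔖.e i x b) =
      ∑ c : Fin 2 × Fin 2, 𝔖.vcomp i v c * (eps c.1 b.1 * eps c.2 b.2) := by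
    conv_lhs => rw [← 𝔖.sum_vcomp (i := i) v]
    simp only [map_sum, map_smul, LinearMap.sum_apply, LinearMap.smul_apply, smul_eq_mul,
      𝔖.e_metric i x hx]
  simp only [key, Fintype.sum_prod_type, Fin.sum_univ_two]
  obtain ⟨A, A'⟩ := a
  fin_cases A <;> fin_cases A' <;> simp [eps]

theorem SpinStructure.vcomp_smoothAt {x : M} (hx : x ∈ 𝔖.U i) {X : ∀ x : M, CT x}
    (hX : VFSmoothAt X x) (a : Fin 2 × Fin 2) : SmoothAt (fun y => 𝔖.vcomp i (X y) a) x := by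
  have h : SmoothAt (fun y => ∑ b : Fin 2 × Fin 2,
      eps a.1 b.1 * eps a.2 b.2 * g.formC y (X y) (𝔖.e i y b)) x :=
    ContMDiffAt.sum fun b _ => SmoothAt.mul contMDiffAt_const
      (g.formC_smoothAt hX (𝔖.frame_smoothAt hx b))
  refine h.congr_of_eventuallyEq ?_
  filter_upwards [(𝔖.isOpen_U i).mem_nhds hx] with y hy
  exact 𝔖.vcomp_eq_formC hy _ a

end MetricComponents

/-! ### The spin connections -/

section SpinConnection

theorem eps_zero_zero : eps 0 0 = 0 := rfl

theorem eps_zero_one : eps 0 1 = 1 := rfl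

theorem eps_one_zero : eps 1 0 = -1 := rfl

theorem eps_one_one : eps 1 1 = 0 := rfl

theorem kron_zero_one : kron 0 1 = 0 := rfl

theorem kron_one_zero : kron 1 0 = 0 := rfl

theorem kron_self (A : Fin 2) : kron A A = 1 := if_pos rfl

/-- A skew bilinear expression in pairs of spinor indices splits as
`T_{BB'CC'} = γ_{BC} ε_{B'C'} + γ'_{B'C'} ε_{BC}`; here the last pair of indices is raised. -/
theorem skew_decomposition (T : Fin 2 × Fin 2 → Fin 2 × Fin 2 → ℂ) (hT : ∀ b c, T b c = -T c b)
    (b c : Fin 2 × Fin 2) :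
    ∑ d : Fin 2 × Fin 2, eps c.1 d.1 * eps c.2 d.2 * T b d =
      raise (fun D => (1 / 2 : ℂ) * ∑ B', ∑ D', eps B' D' * T (b.1, B') (D, D')) c.1 *
          kron b.2 c.2 +
        raise (fun D' => (1 / 2 : ℂ) * ∑ B, ∑ D, eps B D * T (B, b.2) (D, D')) c.2 *
          kron b.1 c.1 := by
  obtain ⟨B, B'⟩ := b
  obtain ⟨C, C'⟩ := c
  have d (b : Fin 2 × Fin 2) : T b b = 0 := self_eq_neg.mp (hT b b)
  have h1 := hT (0, 0) (0, 1)
  have h2 := hT (0, 0) (1, 0)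
  have h3 := hT (0, 0) (1, 1)
  have h4 := hT (0, 1) (1, 0)
  have h5 := hT (0, 1) (1, 1)
  have h6 := hT (1, 0) (1, 1)
  fin_cases B <;> fin_cases B' <;> fin_cases C <;> fin_cases C' <;>
    simp [eps, d, raise, kron, Fintype.sum_prod_type] <;> grind

/-- For skew `T` the form `γ_{BC} = ε^{B'C'} T_{BB'CC'}` is symmetric, that is, trace-free. -/
theorem skew_symm_part (T : Fin 2 × Fin 2 → Fin 2 × Fin 2 → ℂ) (hT : ∀ b c, T b c = -T c b) :
    ∑ B, ∑ C, eps B C * ∑ B', ∑ D', eps B' D' * T (B, B') (C, D') = 0 := by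
  have h1 := hT (0, 0) (1, 1)
  have h2 := hT (0, 1) (1, 0)
  simp [Fin.sum_univ_two, eps]
  linear_combination h1 - h2

variable {M : Type u} [TopologicalSpace M] [ChartedSpace E4 M] [IsManifold (𝓡 4) ∞ M]
variable {g : Metric M} {𝔖 : SpinStructure.{u, v} g} {i : 𝔖.ι}

theorem frameBracket_swap (x : M) (a b : Fin 2 × Fin 2) :
    𝔖.frameBracket i x a b = -𝔖.frameBracket i x b a := lieC_swap _ _ _

/-- Metricity of the connection given by Koszul's formula. -/
theorem leviCivita_skew (x : M) (a b c : Fin 2 × Fin 2) :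
    𝔖.leviCivita i x a b c = -𝔖.leviCivita i x a c b := by
  simp only [SpinStructure.leviCivita, frameBracket_swap x c b, map_neg, LinearMap.neg_apply]
  ring

/-- Vanishing torsion of the connection given by Koszul's formula. -/
theorem leviCivita_torsion (x : M) (a b c : Fin 2 × Fin 2) :
    𝔖.leviCivita i x a b c - 𝔖.leviCivita i x b a c =
      g.formC x (𝔖.frameBracket i x a b) (𝔖.e i x c) := by
  simp only [SpinStructure.leviCivita, frameBracket_swap x b a, map_neg, LinearMap.neg_apply]
  ring

/-- The connection on `𝕊` preserves `ε_{AB}`. -/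
theorem spinCoeff_trace (x : M) (a : Fin 2 × Fin 2) : ∑ B, 𝔖.spinCoeff i x a B B = 0 := by
  have h := skew_symm_part (fun b c => 𝔖.leviCivita i x a b c) (leviCivita_skew x a)
  simp only [SpinStructure.spinCoeff, raise]
  simp only [Fin.sum_univ_two] at h ⊢
  linear_combination (1 / 2 : ℂ) * h

/-- The connection on `𝕊'` preserves `ε_{A'B'}`. -/
theorem spinCoeff'_trace (x : M) (a : Fin 2 × Fin 2) : ∑ B, 𝔖.spinCoeff' i x a B B = 0 := by
  have h := skew_symm_part (fun b c => 𝔖.leviCivita i x a b.swap c.swap)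
    (fun b c => leviCivita_skew x a b.swap c.swap)
  simp only [SpinStructure.spinCoeff', raise]
  simp only [Fin.sum_univ_two, Prod.swap] at h ⊢
  linear_combination (1 / 2 : ℂ) * h

/-- The Levi-Civita connection on vectors is the tensor product of the two spin connections. -/
theorem raise_leviCivita (x : M) (a b c : Fin 2 × Fin 2) :
    ∑ d : Fin 2 × Fin 2, eps c.1 d.1 * eps c.2 d.2 * 𝔖.leviCivita i x a b d =
      𝔖.spinCoeff i x a b.1 c.1 * kron b.2 c.2 + 𝔖.spinCoeff' i x a b.2 c.2 * kron b.1 c.1 :=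
  skew_decomposition (fun b c => 𝔖.leviCivita i x a b c) (leviCivita_skew x a) b c

/-- The torsion-free condition in terms of the spin connections. -/
theorem vcomp_frameBracket {x : M} (hx : x ∈ 𝔖.U i) (a b c : Fin 2 × Fin 2) :
    𝔖.vcomp i (𝔖.frameBracket i x a b) c =
      𝔖.spinCoeff i x a b.1 c.1 * kron b.2 c.2 + 𝔖.spinCoeff' i x a b.2 c.2 * kron b.1 c.1 -
        (𝔖.spinCoeff i x b a.1 c.1 * kron a.2 c.2 +
          𝔖.spinCoeff' i x b a.2 c.2 * kron a.1 c.1) := by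
  rw [← raise_leviCivita, ← raise_leviCivita, ← Finset.sum_sub_distrib, 𝔖.vcomp_eq_formC hx]
  refine Finset.sum_congr rfl fun d _ => ?_
  rw [← leviCivita_torsion]
  ring

end SpinConnection

/-! ### Brackets of linear combinations of vector fields -/

section Combination

variable {M : Type u} [TopologicalSpace M] [ChartedSpace E4 M] [IsManifold (𝓡 4) ∞ M]

theorem VFSmoothAt.congr {X Y : ∀ x : M, CT x} {x : M} (hX : VFSmoothAt X x)
    (h : ∀ᶠ y in nhds x, Y y = X y) : VFSmoothAt Y x :=
  ⟨hX.1.congr_of_eventuallyEq (h.mono fun y hy => by simp only [hy]),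
    hX.2.congr_of_eventuallyEq (h.mono fun y hy => by simp only [hy])⟩

theorem VFSmoothAt.combination {f : Fin 2 → M → ℂ} {F : Fin 2 → ∀ x : M, CT x} {x : M}
    (hf : ∀ a, SmoothAt (f a) x) (hF : ∀ a, VFSmoothAt (F a) x) :
    VFSmoothAt (fun y => ∑ a, f a y • F a y) x := by
  simp only [Fin.sum_univ_two]
  exact ((hF 0).smul (hf 0)).add ((hF 1).smul (hf 1))

/-- The bracket of `X = ∑ f_a F_a` and `Y = ∑ h_b H_b` is
`∑ X(h_b) H_b - ∑ Y(f_a) F_a + ∑ f_a h_b [F_a, H_b]`. -/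
theorem lieC_combination {f h : Fin 2 → M → ℂ} {F H : Fin 2 → ∀ x : M, CT x} {x : M}
    (hf : ∀ a, SmoothAt (f a) x) (hh : ∀ a, SmoothAt (h a) x)
    (hF : ∀ a, VFSmoothAt (F a) x) (hH : ∀ a, VFSmoothAt (H a) x) :
    lieC (fun y => ∑ a, f a y • F a y) (fun y => ∑ a, h a y • H a y) x =
      ∑ b, dirDeriv (h b) x (∑ a, f a x • F a x) • H b x -
        ∑ a, dirDeriv (f a) x (∑ b, h b x • H b x) • F a x +
        ∑ a, ∑ b, (f a x * h b x) • lieC (F a) (H b) x := by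
  simp only [Fin.sum_univ_two]
  rw [lieC_add_right ((hH 0).smul (hh 0)) ((hH 1).smul (hh 1)),
    lieC_smul_right (hh 0) (hH 0), lieC_smul_right (hh 1) (hH 1),
    lieC_add_left ((hF 0).smul (hf 0)) ((hF 1).smul (hf 1)),
    lieC_add_left ((hF 0).smul (hf 0)) ((hF 1).smul (hf 1)),
    lieC_smul_left (hf 0) (hF 0), lieC_smul_left (hf 1) (hF 1),
    lieC_smul_left (hf 0) (hF 0), lieC_smul_left (hf 1) (hF 1)]
  simp only [dirDeriv_add_vec, dirDeriv_smul_vec]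
  module

end Combination

namespace SpinStructure

variable {M : Type u} [TopologicalSpace M] [ChartedSpace E4 M] [IsManifold (𝓡 4) ∞ M]
variable {g : Metric M} {𝔖 : SpinStructure.{u, v} g} {i : 𝔖.ι} {x : M}

theorem vcomp_injective : Function.Injective (𝔖.vcomp i (x := x)) := fun _ _ h =>
  (𝔖.e i x).repr.injective (DFunLike.coe_injective h)

theorem vcomp_add (v w : CT x) (a : Fin 2 × Fin 2) :
    𝔖.vcomp i (v + w) a = 𝔖.vcomp i v a + 𝔖.vcomp i w a := by
  simp only [vcomp, map_add, Finsupp.add_apply]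

theorem vcomp_sub (v w : CT x) (a : Fin 2 × Fin 2) :
    𝔖.vcomp i (v - w) a = 𝔖.vcomp i v a - 𝔖.vcomp i w a := by
  simp only [vcomp, map_sub, Finsupp.sub_apply]

theorem vcomp_smul (c : ℂ) (v : CT x) (a : Fin 2 × Fin 2) :
    𝔖.vcomp i (c • v) a = c * 𝔖.vcomp i v a := by
  simp only [vcomp, map_smul, Finsupp.smul_apply, smul_eq_mul]

theorem vcomp_e (b a : Fin 2 × Fin 2) :
    𝔖.vcomp i (𝔖.e i x b) a = kron b.1 a.1 * kron b.2 a.2 := by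
  rw [vcomp, Module.Basis.repr_self, Finsupp.single_apply]
  simp only [kron, Prod.ext_iff]
  split_ifs <;> simp_all

end SpinStructure

/-! ### The local frame of the eigenbundle -/

namespace Dyad

variable {M : Type u} [TopologicalSpace M] [ChartedSpace E4 M] [IsManifold (𝓡 4) ∞ M]
variable {g : Metric M} {𝔖 : SpinStructure.{u, v} g} (D : Dyad 𝔖) (i : 𝔖.ι)

theorem φ_eq (x : M) : D.φ i x =
    D.α.comp i x 0 * D.β.comp i x 1 - D.α.comp i x 1 * D.β.comp i x 0 := by
  simp [φ, lower, eps]; ring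

theorem αl_zero (x : M) : D.αl i x 0 = -D.α.comp i x 1 := by simp [αl, lower, eps]

theorem αl_one (x : M) : D.αl i x 1 = D.α.comp i x 0 := by simp [αl, lower, eps]

theorem βl_zero (x : M) : D.βl i x 0 = -D.β.comp i x 1 := by simp [βl, lower, eps]

theorem βl_one (x : M) : D.βl i x 1 = D.β.comp i x 0 := by simp [βl, lower, eps]

variable {i}

theorem φ_ne {x : M} (hx : x ∈ 𝔖.U i) : D.φ i x ≠ 0 := D.φ_ne_zero i x hx

theorem smoothAt_α {x : M} (hx : x ∈ 𝔖.U i) (A : Fin 2) :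
    SmoothAt (fun y => D.α.comp i y A) x :=
  (D.α.smooth i A).contMDiffAt ((𝔖.isOpen_U i).mem_nhds hx)

theorem smoothAt_β {x : M} (hx : x ∈ 𝔖.U i) (A : Fin 2) :
    SmoothAt (fun y => D.β.comp i y A) x :=
  (D.β.smooth i A).contMDiffAt ((𝔖.isOpen_U i).mem_nhds hx)

theorem smoothAt_αl {x : M} (hx : x ∈ 𝔖.U i) (A : Fin 2) :
    SmoothAt (fun y => D.αl i y A) x := by
  simp only [αl, lower]
  exact ContMDiffAt.sum fun B _ => SmoothAt.mul contMDiffAt_const (D.smoothAt_α hx B)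

theorem smoothAt_φ {x : M} (hx : x ∈ 𝔖.U i) : SmoothAt (fun y => D.φ i y) x :=
  ContMDiffAt.sum (f := fun A y => D.αl i y A * D.β.comp i y A) fun A _ =>
    (D.smoothAt_αl hx A).mul (D.smoothAt_β hx A)

variable (i)

/-- The local frame `β^A e_{AA'}` of `L`, as complex vector fields. -/
def lframe (A' : Fin 2) (x : M) : CT x := ∑ A, D.β.comp i x A • 𝔖.e i x (A, A')

/-- The function `λ_{A'} = φ⁻¹ α_C β^A ∇_{AA'} β^C`. -/
def lam (x : M) (A' : Fin 2) : ℂ :=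
  (D.φ i x)⁻¹ * ∑ C, D.αl i x C * ∑ A, D.β.comp i x A * 𝔖.nabla i (D.β.comp i) x (A, A') C

/-- The function `μ_{A'} = φ⁻¹ β_C β^A ∇_{AA'} α^C`. -/
def mu (x : M) (A' : Fin 2) : ℂ :=
  (D.φ i x)⁻¹ * ∑ C, D.βl i x C * ∑ A, D.β.comp i x A * 𝔖.nabla i (D.α.comp i) x (A, A') C

/-- The connection coefficients `β^A γ'_{AA'B'}^{C'}` of the primed spin connection along `L`. -/
def primedCoeff (x : M) (A' B' C' : Fin 2) : ℂ :=
  ∑ A, D.β.comp i x A * 𝔖.spinCoeff' i x (A, A') B' C'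

/-- The component `β^A f_{AA'}` of the Lee form along `L`. -/
def leeL (x : M) (A' : Fin 2) : ℂ := ∑ A, D.β.comp i x A * D.lee i x (A, A')

/-- The structure functions of the local frame of `L`. -/
def structFun (x : M) (A' B' C' : Fin 2) : ℂ :=
  D.lam i x A' * kron B' C' - D.lam i x B' * kron A' C' + D.primedCoeff i x A' B' C' -
    D.primedCoeff i x B' A' C'

variable {i}

theorem smoothAt_lframe {x : M} (hx : x ∈ 𝔖.U i) (A' : Fin 2) : VFSmoothAt (D.lframe i A') x :=
  VFSmoothAt.combination (f := fun A y => D.β.comp i y A) (F := fun A y => 𝔖.e i y (A, A'))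
    (D.smoothAt_β hx) fun A => 𝔖.frame_smoothAt hx (A, A')

theorem primedCoeff_trace (x : M) (A' : Fin 2) : ∑ B', D.primedCoeff i x A' B' B' = 0 := by
  have h0 := spinCoeff'_trace (𝔖 := 𝔖) (i := i) x (0, A')
  have h1 := spinCoeff'_trace (𝔖 := 𝔖) (i := i) x (1, A')
  simp only [primedCoeff, Fin.sum_univ_two] at *
  linear_combination D.β.comp i x 0 * h0 + D.β.comp i x 1 * h1

theorem dirDeriv_lframe (f : M → ℂ) (x : M) (A' : Fin 2) :
    dirDeriv f x (D.lframe i A' x) = ∑ A, D.β.comp i x A * 𝔖.der i x (A, A') f := by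
  simp only [lframe, Fin.sum_univ_two, dirDeriv_add_vec, dirDeriv_smul_vec, SpinStructure.der]

/-- `E_{A'} φ = φ (λ_{A'} - μ_{A'})`: the connection term `γ_{AA'B}^B φ` of `∇φ` vanishes, because the
spin connection is trace-free. -/
theorem dirDeriv_φ {x : M} (hx : x ∈ 𝔖.U i) (A' : Fin 2) :
    dirDeriv (D.φ i) x (D.lframe i A' x) = D.φ i x * (D.lam i x A' - D.mu i x A') := by
  have der (v : CT x) : dirDeriv (D.φ i) x v =
      D.α.comp i x 0 * dirDeriv (fun y => D.β.comp i y 1) x v +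
        D.β.comp i x 1 * dirDeriv (fun y => D.α.comp i y 0) x v -
        (D.α.comp i x 1 * dirDeriv (fun y => D.β.comp i y 0) x v +
        D.β.comp i x 0 * dirDeriv (fun y => D.α.comp i y 1) x v) := by
    have e : D.φ i = fun y => D.α.comp i y 0 * D.β.comp i y 1 +
        (-1) * (D.α.comp i y 1 * D.β.comp i y 0) := by
      funext y; rw [φ_eq]; ring
    rw [e, dirDeriv_add ((D.smoothAt_α hx 0).mul (D.smoothAt_β hx 1))
      (SmoothAt.mul contMDiffAt_const ((D.smoothAt_α hx 1).mul (D.smoothAt_β hx 0))),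
      dirDeriv_mul contMDiffAt_const ((D.smoothAt_α hx 1).mul (D.smoothAt_β hx 0)),
      dirDeriv_mul (D.smoothAt_α hx 0) (D.smoothAt_β hx 1),
      dirDeriv_mul (D.smoothAt_α hx 1) (D.smoothAt_β hx 0), dirDeriv_const]
    ring
  rw [der]
  have h0 := spinCoeff_trace (𝔖 := 𝔖) (i := i) x (0, A')
  have h1 := spinCoeff_trace (𝔖 := 𝔖) (i := i) x (1, A')
  have hφ := D.φ_eq i x
  rw [lam, mu, ← mul_sub, mul_inv_cancel_left₀ (D.φ_ne hx)]
  simp only [dirDeriv_lframe, Fin.sum_univ_two, SpinStructure.nabla, αl_zero, αl_one, βl_zero,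
    βl_one] at *
  linear_combination -(D.α.comp i x 0 * D.β.comp i x 1 - D.α.comp i x 1 * D.β.comp i x 0) *
    (D.β.comp i x 0 * h0 + D.β.comp i x 1 * h1)

/-- The shear-free equation says that `β^A ∇_{AA'} β^C` is proportional to `β^C`. -/
theorem nabla_β_of_isShearFree (hS : IsShearFree D.β) {x : M} (hx : x ∈ 𝔖.U i) (A' C : Fin 2) :
    ∑ A, D.β.comp i x A * 𝔖.nabla i (D.β.comp i) x (A, A') C =
      D.lam i x A' * D.β.comp i x C := by
  have h := hS i x hx A'
  -- The equation is stated for `β_A`; its components are `β_0 = -β^1` and `β_1 = β^0`.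
  have d (a : Fin 2 × Fin 2) : 𝔖.der i x a (fun y => lower (D.β.comp i y) 0) =
      -𝔖.der i x a (fun y => D.β.comp i y 1) := by
    have e : (fun y => lower (D.β.comp i y) 0) = fun y => (-1) * D.β.comp i y 1 := by
      funext y; simp [lower, eps]
    rw [e, SpinStructure.der, dirDeriv_mul contMDiffAt_const (D.smoothAt_β hx 1), dirDeriv_const,
      SpinStructure.der]
    ring
  have d' (a : Fin 2 × Fin 2) : 𝔖.der i x a (fun y => lower (D.β.comp i y) 1) =
      𝔖.der i x a (fun y => D.β.comp i y 0) := by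
    have e : (fun y => lower (D.β.comp i y) 1) = fun y => D.β.comp i y 0 := by
      funext y; simp [lower, eps]
    rw [e]
  have l0 : lower (D.β.comp i x) 0 = -D.β.comp i x 1 := D.βl_zero i x
  have l1 : lower (D.β.comp i x) 1 = D.β.comp i x 0 := D.βl_one i x
  simp only [SpinStructure.nablaLow, Fin.sum_univ_two, d, d', l0, l1] at h
  have hφ := D.φ_ne hx
  rw [φ_eq] at hφ
  rw [lam, φ_eq]
  field_simp
  simp only [SpinStructure.nabla, Fin.sum_univ_two, αl_zero, αl_one]
  fin_cases C
  · simp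
    linear_combination D.α.comp i x 0 * h
  · simp
    linear_combination D.α.comp i x 1 * h

theorem vcomp_lframe (x : M) (A' C C' : Fin 2) :
    𝔖.vcomp i (D.lframe i A' x) (C, C') = D.β.comp i x C * kron A' C' := by
  fin_cases C <;> simp [lframe, Fin.sum_univ_two, SpinStructure.vcomp_add,
    SpinStructure.vcomp_smul, SpinStructure.vcomp_e, kron_zero_one, kron_one_zero, kron_self]

theorem vcomp_sum_lframe (x : M) (ν : Fin 2 → ℂ) (A A' : Fin 2) :
    𝔖.vcomp i (∑ B', ν B' • D.lframe i B' x) (A, A') = D.β.comp i x A * ν A' := by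
  fin_cases A' <;> simp [Fin.sum_univ_two, SpinStructure.vcomp_add,
    SpinStructure.vcomp_smul, vcomp_lframe, kron_zero_one, kron_one_zero, kron_self, mul_comm]

theorem structFun_swap (x : M) (A' B' C' : Fin 2) :
    D.structFun i x A' B' C' = -D.structFun i x B' A' C' := by
  rw [structFun, structFun]; ring

theorem structFun_self (x : M) (A' C' : Fin 2) : D.structFun i x A' A' C' = 0 :=
  self_eq_neg.mp (D.structFun_swap x A' A' C')

/-- Involutivity of `L`: the brackets of the local frame fields are sections of `L`. -/
theorem lieC_lframe (hS : IsShearFree D.β) {x : M} (hx : x ∈ 𝔖.U i) (A' B' : Fin 2) :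
    lieC (D.lframe i A') (D.lframe i B') x =
      ∑ C', D.structFun i x A' B' C' • D.lframe i C' x := by
  apply 𝔖.vcomp_injective (i := i)
  funext ⟨C, C'⟩
  have hn := D.nabla_β_of_isShearFree hS hx
  have e : lieC (D.lframe i A') (D.lframe i B') x =
      ∑ B, dirDeriv (fun y => D.β.comp i y B) x (D.lframe i A' x) • 𝔖.e i x (B, B') -
        ∑ A, dirDeriv (fun y => D.β.comp i y A) x (D.lframe i B' x) • 𝔖.e i x (A, A') +
        ∑ A, ∑ B, (D.β.comp i x A * D.β.comp i x B) • 𝔖.frameBracket i x (A, A') (B, B') :=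
    lieC_combination (f := fun A y => D.β.comp i y A) (h := fun A y => D.β.comp i y A)
      (F := fun A y => 𝔖.e i y (A, A')) (H := fun A y => 𝔖.e i y (A, B'))
      (D.smoothAt_β hx) (D.smoothAt_β hx) (fun A => 𝔖.frame_smoothAt hx (A, A'))
      (fun A => 𝔖.frame_smoothAt hx (A, B'))
  have n1 := hn A' C
  have n2 := hn B' C
  rw [e, vcomp_sum_lframe]
  simp only [Fin.sum_univ_two, SpinStructure.vcomp_add, SpinStructure.vcomp_sub,
    SpinStructure.vcomp_smul, SpinStructure.vcomp_e, vcomp_frameBracket hx,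
    dirDeriv_lframe, structFun, primedCoeff, SpinStructure.nabla] at n1 n2 ⊢
  fin_cases C <;>
    simp only [Fin.zero_eta, Fin.mk_one, kron_zero_one, kron_one_zero, kron_self] at n1 n2 ⊢ <;>
    linear_combination kron B' C' * n1 - kron A' C' * n2

theorem spinVec_eq (x : M) (ν : Fin 2 → ℂ) :
    spinVec D.β i x ν = ∑ A', ν A' • D.lframe i A' x := by
  simp [spinVec, lframe, Fin.sum_univ_two]
  module

/-! ### Sections of the eigenbundle -/

theorem exists_toCT_eq {x : M} (hx : x ∈ 𝔖.U i) (v : D.L.Fib x) :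
    ∃ ν : Fin 2 → ℂ, D.toCT v = ∑ A', ν A' • D.lframe i A' x := by
  have hv : D.toCT v ∈ eigenspace D.β x := v.2
  rw [eigenspace_eq D.β hx] at hv
  obtain ⟨ν, hν⟩ := hv
  exact ⟨ν, by rw [← hν, spinVec_eq]⟩

theorem toCT_injective {x : M} : Function.Injective (D.toCT (x := x)) :=
  Subtype.val_injective

/-- The projector `P` restricts to the identity on `L`. -/
theorem P_toCT {x : M} (hx : x ∈ 𝔖.U i) (v : D.L.Fib x) : D.P i x (D.toCT v) = D.toCT v := by
  obtain ⟨ν, hν⟩ := D.exists_toCT_eq hx v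
  rw [hν]
  apply 𝔖.vcomp_injective (i := i)
  funext ⟨C, C'⟩
  have h : 𝔖.vcomp i (D.P i x (∑ A', ν A' • D.lframe i A' x)) (C, C') =
      ∑ b : Fin 2 × Fin 2, (D.φ i x)⁻¹ * D.β.comp i x C * D.αl i x b.1 * kron C' b.2 *
        𝔖.vcomp i (∑ A', ν A' • D.lframe i A' x) b := by
    rw [P, SpinStructure.vcomp, Matrix.repr_toLin]
    rfl
  have hφ := D.φ_ne hx
  rw [h]
  simp only [Fintype.sum_prod_type, vcomp_sum_lframe]
  simp only [φ, Fin.sum_univ_two, αl] at hφ ⊢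
  fin_cases C' <;>
    simp only [Fin.zero_eta, Fin.mk_one, kron_zero_one, kron_one_zero, kron_self] <;>
    field_simp <;> ring

/-- If `X^{AA'} = β^A ν^{A'}`, then `φ⁻¹ α_B X^{BA'} = ν^{A'}`. -/
theorem xi_eq {X : Γ D.L} {x : M} (hx : x ∈ 𝔖.U i) {ν : Fin 2 → ℂ}
    (h : D.secVF X x = ∑ A', ν A' • D.lframe i A' x) : D.xi i X x = ν := by
  funext A'
  have hφ := D.φ_ne hx
  simp only [xi, vecComp, h, vcomp_sum_lframe]
  simp only [φ, Fin.sum_univ_two, αl] at hφ ⊢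
  field_simp

theorem secVF_eq (X : Γ D.L) {x : M} (hx : x ∈ 𝔖.U i) :
    D.secVF X x = ∑ A', D.xi i X x A' • D.lframe i A' x := by
  obtain ⟨ν, hν⟩ := D.exists_toCT_eq hx (X.1 x)
  rw [D.xi_eq hx hν]
  exact hν

theorem vecComp_eq (X : Γ D.L) {x : M} (hx : x ∈ 𝔖.U i) (A A' : Fin 2) :
    D.vecComp i X x (A, A') = D.β.comp i x A * D.xi i X x A' := by
  rw [vecComp, D.secVF_eq X hx, vcomp_sum_lframe]

theorem toCT_frame_eq {x : M} (hx : x ∈ 𝔖.U i) (k : Fin 2) :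
    D.toCT (D.L.frame i x hx k) = D.lframe i k x := by
  rw [toCT_frame, spinVec_eq]
  simp [Pi.single_apply]

theorem smoothAt_secVF (X : Γ D.L) (x : M) : VFSmoothAt (D.secVF X) x := by
  obtain ⟨i, hi⟩ := 𝔖.cover x
  obtain ⟨c, hc, hc'⟩ := X.2 i
  refine (VFSmoothAt.combination (f := c) (F := D.lframe i)
    (fun a => (hc a).contMDiffAt ((𝔖.isOpen_U i).mem_nhds hi))
    (D.smoothAt_lframe hi)).congr ?_
  filter_upwards [(𝔖.isOpen_U i).mem_nhds hi] with y hy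
  rw [secVF, hc' y hy, map_sum]
  exact Finset.sum_congr rfl fun k _ => by rw [map_smul, toCT_frame_eq]

theorem smoothAt_xi (X : Γ D.L) {x : M} (hx : x ∈ 𝔖.U i) (A' : Fin 2) :
    SmoothAt (fun y => D.xi i X y A') x :=
  ((D.smoothAt_φ hx).inv (D.φ_ne hx)).mul
    (ContMDiffAt.sum (f := fun B y => D.αl i y B * D.vecComp i X y (B, A')) fun B _ =>
      (D.smoothAt_αl hx B).mul (𝔖.vcomp_smoothAt hx (D.smoothAt_secVF X x) _))

/-- A smooth complex vector field with values in `L` is a smooth section of `L`. -/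
theorem isSmoothSection_of_smoothAt (s : ∀ x, D.L.Fib x)
    (hs : ∀ x, VFSmoothAt (fun y => D.toCT (s y)) x) : IsSmoothSection D.L s := by
  intro (i : 𝔖.ι)
  refine ⟨fun A' y => (D.φ i y)⁻¹ * ∑ B, D.αl i y B * 𝔖.vcomp i (D.toCT (s y)) (B, A'),
    fun A' x hx => (SmoothAt.mul ((D.smoothAt_φ hx).inv (D.φ_ne hx))
    (ContMDiffAt.sum (f := fun B y => D.αl i y B * 𝔖.vcomp i (D.toCT (s y)) (B, A')) fun B _ =>
      (D.smoothAt_αl hx B).mul (𝔖.vcomp_smoothAt hx (hs x) _))).contMDiffWithinAt, ?_⟩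
  intro x (hx : x ∈ 𝔖.U i)
  apply D.toCT_injective
  obtain ⟨ν, hν⟩ := D.exists_toCT_eq hx (s x)
  rw [map_sum, hν]
  refine Finset.sum_congr rfl fun A' _ => ?_
  have hφ := D.φ_ne hx
  have hf : D.toCT (D.L.frame i x hx A') = D.lframe i A' x := D.toCT_frame_eq hx A'
  rw [map_smul, hf]
  congr 1
  simp only [hν, vcomp_sum_lframe]
  simp only [φ, Fin.sum_univ_two, αl] at hφ ⊢
  field_simp

/-- The bracket of two sections of `L` in the local frame. -/
theorem lieC_secVF (hS : IsShearFree D.β) (X Y : Γ D.L) {x : M} (hx : x ∈ 𝔖.U i) :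
    lieC (D.secVF X) (D.secVF Y) x = ∑ A',
      (dirDeriv (fun y => D.xi i Y y A') x (D.secVF X x) -
        dirDeriv (fun y => D.xi i X y A') x (D.secVF Y x) +
        ∑ B', ∑ C', D.xi i X x B' * D.xi i Y x C' * D.structFun i x B' C' A') •
        D.lframe i A' x := by
  have ev (Z : Γ D.L) : ∀ᶠ y in nhds x,
      D.secVF Z y = ∑ A', D.xi i Z y A' • D.lframe i A' y := by
    filter_upwards [(𝔖.isOpen_U i).mem_nhds hx] with y hy
    exact D.secVF_eq Z hy
  rw [lieC_congr (ev X) (ev Y), lieC_combination (D.smoothAt_xi X hx) (D.smoothAt_xi Y hx)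
    (D.smoothAt_lframe hx) (D.smoothAt_lframe hx), ← D.secVF_eq X hx, ← D.secVF_eq Y hx]
  simp only [D.lieC_lframe hS hx, Fin.sum_univ_two]
  module

/-- Sections of `L` are closed under the Lie bracket. -/
theorem lieC_mem (hS : IsShearFree D.β) (X Y : Γ D.L) (x : M) :
    lieC (D.secVF X) (D.secVF Y) x ∈ eigenspace D.β x := by
  obtain ⟨i, hx⟩ := 𝔖.cover x
  rw [D.lieC_secVF hS X Y hx, ← spinVec_eq, eigenspace_eq D.β hx]
  exact ⟨_, rfl⟩

/-- The Lie bracket of two sections of `L`, as a section of `L`. -/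
def secBracket (hS : IsShearFree D.β) (X Y : Γ D.L) : Γ D.L :=
  ⟨fun x => (⟨_, D.lieC_mem hS X Y x⟩ : eigenspace D.β x),
    D.isSmoothSection_of_smoothAt _ fun x =>
      (D.smoothAt_secVF X x).lieC (D.smoothAt_secVF Y x)⟩

theorem secVF_injective : Function.Injective D.secVF := fun _ _ h =>
  Subtype.ext (funext fun x => D.toCT_injective (congrFun h x))

/-! ### The Lie algebroid -/

/-- The complex Lie algebroid structure of `L`: the anchor is the inclusion in `TM ⊗ ℂ` and the
bracket is the Lie bracket of complex vector fields. -/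
def lieAlgebroid (hS : IsShearFree D.β) : LieAlgebroid D.L where
  bracket := LinearMap.mk₂ ℂ (D.secBracket hS)
    (fun X Y Z => D.secVF_injective (funext fun x =>
      lieC_add_left (D.smoothAt_secVF X x) (D.smoothAt_secVF Y x)))
    (fun c X Y => D.secVF_injective (funext fun x => by
      have h := lieC_smul_left (f := fun _ => c) (Y := D.secVF Y) contMDiffAt_const
        (D.smoothAt_secVF X x)
      rw [dirDeriv_const, zero_smul, neg_zero, zero_add] at h
      exact h))
    (fun X Y Z => D.secVF_injective (funext fun x =>
      lieC_add_right (D.smoothAt_secVF Y x) (D.smoothAt_secVF Z x)))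
    (fun c X Y => D.secVF_injective (funext fun x => by
      have h := lieC_smul_right (f := fun _ => c) (X := D.secVF X) contMDiffAt_const
        (D.smoothAt_secVF Y x)
      rw [dirDeriv_const, zero_smul, zero_add] at h
      exact h))
  anchor x := D.toCT
  anchor_smooth i k := ⟨D.lframe i k,
    ⟨fun x hx => (D.smoothAt_lframe hx k).1.contMDiffWithinAt,
      fun x hx => (D.smoothAt_lframe hx k).2.contMDiffWithinAt⟩,
    fun x hx => D.toCT_frame_eq hx k⟩
  skew X Y := D.secVF_injective (funext fun x => lieC_swap _ _ x)
  jacobi X Y Z := D.secVF_injective (funext fun x =>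
    lieC_jacobi (D.smoothAt_secVF X) (D.smoothAt_secVF Y) (D.smoothAt_secVF Z) x)
  anchor_bracket X Y x := rfl
  leibniz X Y f x := D.toCT_injective (lieC_smul_right f.contMDiff.contMDiffAt
    (D.smoothAt_secVF Y x))

theorem xi_bracket (hS : IsShearFree D.β) (X Y : Γ D.L) {x : M} (hx : x ∈ 𝔖.U i) (A' : Fin 2) :
    D.xi i ((D.lieAlgebroid hS).bracket X Y) x A' =
      dirDeriv (fun y => D.xi i Y y A') x (D.secVF X x) -
        dirDeriv (fun y => D.xi i X y A') x (D.secVF Y x) +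
        ∑ B', ∑ C', D.xi i X x B' * D.xi i Y x C' * D.structFun i x B' C' A' :=
  congrFun (D.xi_eq (X := (D.lieAlgebroid hS).bracket X Y) hx (D.lieC_secVF hS X Y hx)) A'

/-! ### The gauge-covariant derivative along the eigenbundle -/

/-- The gauge term along `L`. The part `φ⁻¹ β_A f_{A'B} α^B` of `L_{AA'}` is annihilated by `β^A`,
and the part `φ⁻¹ α_A f_{A'B} β^B` of `M_{AA'}` contributes the `1` in `w₁ + 1`. -/
theorem sum_gaugeTerm {x : M} (hx : x ∈ 𝔖.U i) (r r' w : ℝ) (A' : Fin 2) :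
    ∑ A, D.β.comp i x A * D.gaugeTerm i r r' w x (A, A') =
      (w - r * D.w₀ - r' * (D.w₁ + 1)) * D.leeL i x A' + r * D.mu i x A' - r' * D.lam i x A' := by
  have hφ := D.φ_ne hx
  simp only [gaugeTerm, connL, connM, leeL, mu, lam, Fin.sum_univ_two, αl_zero, αl_one,
    βl_zero, βl_one]
  field_simp
  rw [φ_eq]
  ring

/-- `𝒞_{A'} s` in the local frame of `L`. -/
theorem CScalar_eq {x : M} (hx : x ∈ 𝔖.U i) (r r' w : ℝ) (s : M → ℂ) (A' : Fin 2) :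
    D.CScalar i r r' w s x A' = dirDeriv s x (D.lframe i A' x) +
      ((w - r * D.w₀ - r' * (D.w₁ + 1)) * D.leeL i x A' + r * D.mu i x A' - r' * D.lam i x A') *
        s x := by
  rw [← D.sum_gaugeTerm hx, dirDeriv_lframe, CScalar]
  simp only [covScalar, Fin.sum_univ_two]
  ring

/-- `𝒞_{A'} ψ^{B'} = β^A 𝒞_{AA'} ψ^{B'}` in the local frame of `L`. -/
theorem CPrimed_eq {x : M} (hx : x ∈ 𝔖.U i) (r r' w : ℝ) (ψ : M → Fin 2 → ℂ) (A' B' : Fin 2) :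
    D.CPrimed i r r' w ψ x A' B' = dirDeriv (fun y => ψ y B') x (D.lframe i A' x) +
      ∑ C', D.primedCoeff i x A' C' B' * ψ x C' + kron A' B' * ∑ X', D.leeL i x X' * ψ x X' +
      ((w - r * D.w₀ - r' * (D.w₁ + 1)) * D.leeL i x A' + r * D.mu i x A' - r' * D.lam i x A') *
        ψ x B' := by
  rw [← D.sum_gaugeTerm hx, dirDeriv_lframe, CPrimed]
  simp only [covPrimed, weyl', SpinStructure.nabla', leeL, primedCoeff, Fin.sum_univ_two]
  ring

theorem dirDeriv_secVF (f : M → ℂ) (X : Γ D.L) {x : M} (hx : x ∈ 𝔖.U i) :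
    dirDeriv f x (D.secVF X x) = ∑ A', D.xi i X x A' * dirDeriv f x (D.lframe i A' x) := by
  rw [D.secVF_eq X hx]
  simp only [Fin.sum_univ_two, dirDeriv_add_vec, dirDeriv_smul_vec]

/-- In `x^{B'} 𝒞_{B'} y^{A'} - y^{B'} 𝒞_{B'} x^{A'}` the Weyl terms `x^{A'} F·y - y^{A'} F·x` cancel the
Lee part of the gauge terms, `(F·x) y^{A'} - (F·y) x^{A'}`. -/
theorem vecComp_bracket (hS : IsShearFree D.β) (X Y : Γ D.L) {x : M} (hx : x ∈ 𝔖.U i)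
    (A A' : Fin 2) :
    D.vecComp i ((D.lieAlgebroid hS).bracket X Y) x (A, A') = D.bracketRHS i X Y x A A' := by
  rw [D.vecComp_eq _ hx, D.xi_bracket hS X Y hx, bracketRHS]
  congr 1
  simp only [D.CPrimed_eq hx, D.dirDeriv_secVF _ _ hx, structFun]
  push_cast
  fin_cases A' <;>
    simp only [Fin.sum_univ_two, Fin.zero_eta, Fin.mk_one, kron_zero_one, kron_one_zero,
      kron_self] <;>
    ring

/-- Contraction of a 1-form `α_A h_{A'}` with a section `β^A x^{A'}` of `L`. -/
theorem sum_alpha_vecComp (X : Γ D.L) {x : M} (hx : x ∈ 𝔖.U i) (h : Fin 2 → ℂ) :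
    ∑ A, ∑ A', D.αl i x A * h A' * D.vecComp i X x (A, A') =
      D.φ i x * ∑ A', h A' * D.xi i X x A' := by
  simp only [D.vecComp_eq X hx, φ, αl, Fin.sum_univ_two]
  ring

theorem extD_function (hS : IsShearFree D.β) (f : C^∞⟮𝓡 4, M; 𝓘(ℝ, ℂ), ℂ⟯) (X : Fin 1 → Γ D.L)
    {x : M} (hx : x ∈ 𝔖.U i) :
    (D.lieAlgebroid hS).extD (cochain₀ D.L f) X x =
      ∑ A, ∑ A', D.dFunRHS i f x A A' * D.vecComp i (X 0) x (A, A') := by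
  have h : (D.lieAlgebroid hS).extD (cochain₀ D.L f) X x =
      dirDeriv f x (D.secVF (X 0) x) := by
    have e : (D.lieAlgebroid hS).extD (cochain₀ D.L f) X x =
        ∑ i : Fin 1, (-1 : ℂ) ^ (i : ℕ) * dirDeriv f x (D.secVF (X i) x) := rfl
    rw [e, Fin.sum_univ_one, Fin.val_zero, pow_zero, one_mul]
  rw [h, D.dirDeriv_secVF _ _ hx]
  have e := D.sum_alpha_vecComp (X 0) hx fun A' => (D.φ i x)⁻¹ * D.CScalar i 0 0 0 f x A'
  have hφ := D.φ_ne hx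
  have c (A A' : Fin 2) : D.dFunRHS i f x A A' =
      D.αl i x A * ((D.φ i x)⁻¹ * D.CScalar i 0 0 0 f x A') := by rw [dFunRHS]; ring
  simp only [c]
  rw [e]
  simp only [D.CScalar_eq hx, Fin.sum_univ_two]
  push_cast
  field_simp
  ring

/-! ### The exterior derivative -/

/-- The spinor `x^{A'}` of a section is its tuple of components in the local frame of `L`. -/
theorem frame_repr (X : Γ D.L) {x : M} (hx : x ∈ 𝔖.U i) (A' : Fin 2) :
    (D.L.frame i x hx).repr (X.1 x) A' = D.xi i X x A' := by
  have h : X.1 x = ∑ A', D.xi i X x A' • D.L.frame i x hx A' := by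
    apply D.toCT_injective
    rw [map_sum]
    refine (D.secVF_eq X hx).trans (Finset.sum_congr rfl fun k _ => ?_)
    rw [map_smul, D.toCT_frame_eq hx]
  rw [h, Module.Basis.repr_sum_self]

/-- The components of a 1-form in the local frame of `L` are `ω(E_{A'}) = φ ω_{A'}`. -/
theorem omegaLow_eq (η : BForm D.L 1) {x : M} (hx : x ∈ 𝔖.U i) (A' : Fin 2) :
    D.φ i x * D.omegaLow i η x A' = η.toFun x (fun _ => D.L.frame i x hx A') := by
  rw [omegaLow, dif_pos hx, mul_inv_cancel_left₀ (D.φ_ne hx)]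

theorem smoothAt_omegaLow (η : BForm D.L 1) {x : M} (hx : x ∈ 𝔖.U i) (A' : Fin 2) :
    SmoothAt (fun y => D.omegaLow i η y A') x := by
  obtain ⟨c, hc, hc'⟩ := η.smooth i fun _ => A'
  have hn := (𝔖.isOpen_U i).mem_nhds hx
  refine ContMDiffAt.congr_of_eventuallyEq
    (((D.smoothAt_φ hx).inv (D.φ_ne hx)).mul (hc.contMDiffAt hn)) ?_
  filter_upwards [hn] with y hy
  rw [omegaLow, dif_pos hy, hc' y hy]

/-- `ω(X) = φ x^{A'} ω_{A'}`. -/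
theorem cochain_one (η : BForm D.L 1) (X : Fin 1 → Γ D.L) {x : M} (hx : x ∈ 𝔖.U i) :
    η.cochain X x = D.φ i x * ∑ A', D.xi i (X 0) x A' * D.omegaLow i η x A' := by
  have h (v : D.L.Fib x) : η.toFun x (fun _ => v) =
      ∑ A', (D.L.frame i x hx).repr v A' * (D.φ i x * D.omegaLow i η x A') := by
    let l := (AlternatingMap.ofSubsingleton ℂ (D.L.Fib x) ℂ (0 : Fin 1)).symm (η.toFun x)
    have hl (v : D.L.Fib x) : l v = η.toFun x (fun _ => v) := rfl
    rw [← hl, ← (D.L.frame i x hx).sum_repr v, map_sum]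
    refine Finset.sum_congr rfl fun k _ => ?_
    rw [map_smul, hl, D.omegaLow_eq, Module.Basis.sum_repr, smul_eq_mul]
  have e : (fun m => (X m).1 x) = fun _ => (X 0).1 x := funext fun m => by
    rw [Subsingleton.elim m 0]
  rw [BForm.cochain, e, h]
  simp only [D.frame_repr, Fin.sum_univ_two]
  ring

/-- The divergence `𝒞_{C'} ω^{C'}` in the local frame. The Lee form cancels: the Weyl term
contributes `2 F_{C'} ω^{C'}` and the gauge term of type `(-1, 0; -w₀ - 2)` the opposite. -/
theorem divOmega_eq (η : BForm D.L 1) {x : M} (hx : x ∈ 𝔖.U i) :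
    D.divOmega i η x = dirDeriv (fun y => D.omegaLow i η y 1) x (D.lframe i 0 x) -
        dirDeriv (fun y => D.omegaLow i η y 0) x (D.lframe i 1 x) +
        ((∑ C', D.primedCoeff i x C' 0 C') - D.mu i x 0) * D.omegaLow i η x 1 -
        ((∑ C', D.primedCoeff i x C' 1 C') - D.mu i x 1) * D.omegaLow i η x 0 := by
  have u0 (y : M) : D.omegaUp i η y 0 = D.omegaLow i η y 1 := by simp [omegaUp, raise, eps]
  have u1 (y : M) : D.omegaUp i η y 1 = -D.omegaLow i η y 0 := by simp [omegaUp, raise, eps]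
  simp only [divOmega, D.CPrimed_eq hx, Fin.sum_univ_two, u0, u1, kron_self,
    dirDeriv_neg _ x (D.smoothAt_omegaLow η hx 0)]
  push_cast
  ring

theorem dirDeriv_cochain (η : BForm D.L 1) (X : Fin 1 → Γ D.L) {x : M} (hx : x ∈ 𝔖.U i)
    (v : CT x) :
    dirDeriv (η.cochain X) x v =
      dirDeriv (fun y => D.φ i y * ∑ A', D.xi i (X 0) y A' * D.omegaLow i η y A') x v := by
  apply dirDeriv_congr
  filter_upwards [(𝔖.isOpen_U i).mem_nhds hx] with y hy
  exact D.cochain_one η X hy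

theorem dirDeriv_pairing (η : BForm D.L 1) (X : Γ D.L) {x : M} (hx : x ∈ 𝔖.U i) (v : CT x) :
    dirDeriv (fun y => ∑ A', D.xi i X y A' * D.omegaLow i η y A') x v =
      ∑ A', (D.xi i X x A' * dirDeriv (fun y => D.omegaLow i η y A') x v +
        D.omegaLow i η x A' * dirDeriv (fun y => D.xi i X y A') x v) := by
  simp only [Fin.sum_univ_two]
  have s (A' : Fin 2) := D.smoothAt_xi X hx A'
  have t (A' : Fin 2) := D.smoothAt_omegaLow η hx A'
  rw [dirDeriv_add ((s 0).mul (t 0)) ((s 1).mul (t 1)), dirDeriv_mul (s 0) (t 0),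
    dirDeriv_mul (s 1) (t 1)]

theorem smoothAt_pairing (η : BForm D.L 1) (X : Γ D.L) {x : M} (hx : x ∈ 𝔖.U i) :
    SmoothAt (fun y => ∑ A', D.xi i X y A' * D.omegaLow i η y A') x :=
  ContMDiffAt.sum (f := fun A' y => D.xi i X y A' * D.omegaLow i η y A') fun A' _ =>
    (D.smoothAt_xi X hx A').mul (D.smoothAt_omegaLow η hx A')

/-- `dω(X, Y) = X(ω(Y)) - Y(ω(X)) - ω([X, Y])`. -/
theorem extD_one_form_eq (hS : IsShearFree D.β) (η : BForm D.L 1) (X : Fin 2 → Γ D.L) (x : M) :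
    (D.lieAlgebroid hS).extD η.cochain X x =
      dirDeriv (η.cochain fun _ => X 1) x (D.secVF (X 0) x) -
        dirDeriv (η.cochain fun _ => X 0) x (D.secVF (X 1) x) -
        η.cochain (fun _ => (D.lieAlgebroid hS).bracket (X 0) (X 1)) x := by
  -- The families indexed by `Fin 1` in the two sums are constant.
  have key (F : Fin 1 → Γ D.L) : η.cochain F = η.cochain fun _ => F 0 :=
    congrArg _ (funext fun m => by rw [Fin.fin_one_eq_zero m])
  have e₁ : (D.lieAlgebroid hS).extD₁ η.cochain X x =
      ∑ i : Fin 2, (-1 : ℂ) ^ (i : ℕ) *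
        dirDeriv (η.cochain fun m : Fin 1 => X (i.succAbove m)) x (D.secVF (X i) x) := rfl
  have e₂ : (D.lieAlgebroid hS).extD₂ η.cochain X x =
      ∑ j : Fin 2, ∑ i : Fin 1, if i.castSucc < j then (-1 : ℂ) ^ ((i : ℕ) + (j : ℕ)) *
        η.cochain (Fin.cons ((D.lieAlgebroid hS).bracket (X i.castSucc) (X j))
          (fun m : Fin 0 => X (j.succAbove (i.succAbove m)))) x else 0 := rfl
  have e : (D.lieAlgebroid hS).extD η.cochain X x =
      (D.lieAlgebroid hS).extD₁ η.cochain X x + (D.lieAlgebroid hS).extD₂ η.cochain X x := rfl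
  rw [e, e₁, e₂]
  simp only [Fin.sum_univ_two, Fin.sum_univ_one]
  rw [if_neg (by decide), if_pos (by decide), key fun m => X (Fin.succAbove 0 m),
    key fun m => X (Fin.succAbove 1 m), key (Fin.cons _ _), Fin.cons_zero]
  change (-1 : ℂ) ^ 0 * dirDeriv (η.cochain fun _ => X 1) x (D.secVF (X 0) x) +
    (-1) ^ 1 * dirDeriv (η.cochain fun _ => X 0) x (D.secVF (X 1) x) +
    (0 + (-1) ^ 1 * η.cochain (fun _ => (D.lieAlgebroid hS).bracket (X 0) (X 1)) x) = _
  ring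

/-- `dω(X, Y) = φ (𝒞_{C'} ω^{C'}) (x^0 y^1 - x^1 y^0)`. -/
theorem extD_one_form (hS : IsShearFree D.β) (η : BForm D.L 1) (X : Fin 2 → Γ D.L)
    {x : M} (hx : x ∈ 𝔖.U i) :
    (D.lieAlgebroid hS).extD η.cochain X x = D.φ i x * D.divOmega i η x *
      (D.xi i (X 0) x 0 * D.xi i (X 1) x 1 - D.xi i (X 0) x 1 * D.xi i (X 1) x 0) := by
  rw [extD_one_form_eq, D.dirDeriv_cochain _ _ hx, D.dirDeriv_cochain _ _ hx,
    D.cochain_one _ _ hx, dirDeriv_mul (D.smoothAt_φ hx) (D.smoothAt_pairing η _ hx),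
    dirDeriv_mul (D.smoothAt_φ hx) (D.smoothAt_pairing η _ hx),
    D.dirDeriv_pairing _ _ hx, D.dirDeriv_pairing _ _ hx]
  -- The traces of the primed connection match the divergence with the structure functions.
  have t0 := D.primedCoeff_trace (i := i) x 0
  have t1 := D.primedCoeff_trace (i := i) x 1
  simp only [D.xi_bracket hS _ _ hx, D.dirDeriv_secVF _ _ hx, D.dirDeriv_φ hx, D.divOmega_eq η hx,
    structFun, Fin.sum_univ_two, kron_zero_one, kron_one_zero, kron_self] at t0 t1 ⊢
  linear_combination D.φ i x *
    (D.xi i (X 0) x 0 * D.xi i (X 1) x 1 - D.xi i (X 0) x 1 * D.xi i (X 1) x 0) *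
    (D.omegaLow i η x 0 * t1 - D.omegaLow i η x 1 * t0)

theorem extD_one_form_components (hS : IsShearFree D.β) (η : BForm D.L 1) (X : Fin 2 → Γ D.L)
    {x : M} (hx : x ∈ 𝔖.U i) :
    (D.lieAlgebroid hS).extD η.cochain X x =
      ∑ A, ∑ A', ∑ B, ∑ B', D.dFormRHS i η x A A' B B' *
        D.vecComp i (X 0) x (A, A') * D.vecComp i (X 1) x (B, B') := by
  have hφ := D.φ_ne hx
  rw [D.extD_one_form hS η X hx]
  simp only [dFormRHS, D.vecComp_eq _ hx, Fin.sum_univ_two, eps_zero_zero, eps_zero_one,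
    eps_one_zero, eps_one_one]
  simp only [φ_eq, αl_zero, αl_one] at hφ ⊢
  field_simp
  ring

theorem lieD_one_form (hS : IsShearFree D.β) (X : Γ D.L) (η : BForm D.L 1) (Y : Fin 1 → Γ D.L)
    {x : M} (hx : x ∈ 𝔖.U i) :
    (D.lieAlgebroid hS).lieD X η.cochain Y x =
      ∑ A, ∑ A', D.lieRHS i X η x A A' * D.vecComp i (Y 0) x (A, A') := by
  have e : (D.lieAlgebroid hS).lieD X η.cochain Y x =
      (D.lieAlgebroid hS).extD η.cochain (Fin.cons X Y) x +
        dirDeriv (η.cochain (fun _ => X)) x (D.secVF (Y 0) x) := by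
    have key : η.cochain (Fin.cons X fun m : Fin 0 => Y m.succ) = η.cochain fun _ => X :=
      congrArg _ (funext fun m => by rw [Fin.fin_one_eq_zero m]; rfl)
    have h : (D.lieAlgebroid hS).lieD X η.cochain Y x =
      (D.lieAlgebroid hS).extD η.cochain (Fin.cons X Y) x +
        (D.lieAlgebroid hS).extD₁ (LieAlgebroid.interior X η.cochain) Y x := rfl
    have h' : (D.lieAlgebroid hS).extD₁ (LieAlgebroid.interior X η.cochain) Y x =
      ∑ i : Fin 1, (-1 : ℂ) ^ (i : ℕ) *
        dirDeriv (η.cochain (Fin.cons X fun m : Fin 0 => Y (i.succAbove m))) x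
          (D.secVF (Y i) x) := rfl
    rw [h, h', Fin.sum_univ_one, Fin.val_zero, pow_zero, one_mul, ← key]
    rfl
  have c (A A' : Fin 2) : D.lieRHS i X η x A A' = D.αl i x A *
      (lower (D.xi i X x) A' * D.divOmega i η x +
      D.CScalar i (-1) (-1) (-D.w₀ - D.w₁ - 1)
        (fun y => ∑ B', D.xi i X y B' * D.omegaLow i η y B') x A') := by rw [lieRHS]
  simp only [c, D.sum_alpha_vecComp (Y 0) hx]
  rw [e, D.extD_one_form hS _ _ hx, D.dirDeriv_cochain _ _ hx,
    dirDeriv_mul (D.smoothAt_φ hx) (D.smoothAt_pairing η _ hx), D.dirDeriv_secVF _ _ hx,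
    D.dirDeriv_secVF _ _ hx]
  simp only [D.CScalar_eq hx, D.dirDeriv_φ hx, Fin.sum_univ_two, Fin.cons_zero, Fin.cons_one,
    lower, eps_zero_zero, eps_zero_one, eps_one_zero, eps_one_one]
  push_cast
  ring

/-- `η(X, Y) = η(E_0, E_1) (x^0 y^1 - x^1 y^0)` for a 2-form. -/
theorem cochain_two (η : BForm D.L 2) (X : Fin 2 → Γ D.L) {x : M} (hx : x ∈ 𝔖.U i) :
    η.cochain X x = η.toFun x (D.L.frame i x hx) *
      (D.xi i (X 0) x 0 * D.xi i (X 1) x 1 - D.xi i (X 0) x 1 * D.xi i (X 1) x 0) := by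
  have h := congrArg (fun f : (D.L.Fib x) [⋀^Fin 2]→ₗ[ℂ] ℂ => f fun m => (X m).1 x)
    (AlternatingMap.eq_smul_basis_det (D.L.frame i x hx) (η.toFun x))
  refine h.trans ?_
  simp only [AlternatingMap.smul_apply, smul_eq_mul, Module.Basis.det_apply, Matrix.det_fin_two,
    Module.Basis.toMatrix_apply, D.frame_repr _ hx]
  ring

/-- A form of degree greater than the rank vanishes. -/
theorem cochain_eq_zero {k : ℕ} (hk : 2 < k) (η : BForm D.L k) : η.cochain = 0 := by
  funext X x
  obtain ⟨i, hx⟩ := 𝔖.cover x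
  -- More than two vectors of a two-dimensional space are linearly dependent.
  have b := D.L.frame i x hx
  have : Module.Finite ℂ (D.L.Fib x) := Module.Finite.of_basis b
  refine AlternatingMap.map_linearDependent _ _ fun h => ?_
  have := h.fintype_card_le_finrank
  rw [Module.finrank_eq_card_basis b] at this
  simp at this
  omega

theorem extD_zero (𝓐 : LieAlgebroid D.L) {k : ℕ} (X : Fin (k + 1) → Γ D.L) (x : M) :
    𝓐.extD (0 : Cochain D.L k) X x = 0 := by
  have h₁ (k : ℕ) (X : Fin (k + 1) → Γ D.L) : 𝓐.extD₁ (0 : Cochain D.L k) X x = 0 := by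
    rw [LieAlgebroid.extD₁]
    refine Finset.sum_eq_zero fun i _ => ?_
    have : dirDeriv (fun _ : M => (0 : ℂ)) x (𝓐.anchor x ((X i).1 x)) = 0 := dirDeriv_const _ _ _
    rw [show ((0 : Cochain D.L k) fun m => X (i.succAbove m)) = fun _ => 0 from rfl, this, mul_zero]
  cases k with
  | zero => exact h₁ 0 X
  | succ k =>
    have h₂ : 𝓐.extD₂ (0 : Cochain D.L (k + 1)) X x = 0 := by
      simp [LieAlgebroid.extD₂]
    have e : 𝓐.extD (0 : Cochain D.L (k + 1)) X x = 𝓐.extD₁ (0 : Cochain D.L (k + 1)) X x +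
      𝓐.extD₂ (0 : Cochain D.L (k + 1)) X x := rfl
    rw [e, h₁, h₂, add_zero]

/-- In the local frame a 2-form is a function `c` times the determinant `x^0 y^1 - x^1 y^0`, and the
expansion of `dη(X, Y, Z)` is a polynomial identity in the components of three vectors in a plane,
their derivatives, the derivatives of `c` and the structure functions. -/
theorem extD_two_form (hS : IsShearFree D.β) (η : BForm D.L 2) (X : Fin 3 → Γ D.L) (x : M) :
    (D.lieAlgebroid hS).extD η.cochain X x = 0 := by
  obtain ⟨i, hx⟩ := 𝔖.cover x
  obtain ⟨c, hc, hc'⟩ := η.smooth i id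
  have hn := (𝔖.isOpen_U i).mem_nhds hx
  have hcx : SmoothAt c x := hc.contMDiffAt hn
  have val (F : Fin 2 → Γ D.L) {y : M} (hy : y ∈ 𝔖.U i) : η.cochain F y =
      c y * (D.xi i (F 0) y 0 * D.xi i (F 1) y 1 + -(D.xi i (F 0) y 1 * D.xi i (F 1) y 0)) := by
    rw [D.cochain_two η F hy, ← hc' y hy]
    rfl
  have s (Z : Γ D.L) (A' : Fin 2) := D.smoothAt_xi Z hx A'
  have der (F : Fin 2 → Γ D.L) (v : CT x) : dirDeriv (η.cochain F) x v =
      c x * (D.xi i (F 0) x 0 * dirDeriv (fun y => D.xi i (F 1) y 1) x v +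
        D.xi i (F 1) x 1 * dirDeriv (fun y => D.xi i (F 0) y 0) x v -
        (D.xi i (F 0) x 1 * dirDeriv (fun y => D.xi i (F 1) y 0) x v +
        D.xi i (F 1) x 0 * dirDeriv (fun y => D.xi i (F 0) y 1) x v)) +
      (D.xi i (F 0) x 0 * D.xi i (F 1) x 1 - D.xi i (F 0) x 1 * D.xi i (F 1) x 0) *
        dirDeriv c x v := by
    have e : dirDeriv (η.cochain F) x v = dirDeriv (fun y => c y * (D.xi i (F 0) y 0 *
        D.xi i (F 1) y 1 + -(D.xi i (F 0) y 1 * D.xi i (F 1) y 0))) x v := by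
      apply dirDeriv_congr
      filter_upwards [hn] with y hy
      exact val F hy
    have m01 := (s (F 0) 0).mul (s (F 1) 1)
    have m10 := (s (F 0) 1).mul (s (F 1) 0)
    have m10' : SmoothAt (fun y => -(D.xi i (F 0) y 1 * D.xi i (F 1) y 0)) x := m10.neg
    have m : SmoothAt (fun y => D.xi i (F 0) y 0 * D.xi i (F 1) y 1 +
      -(D.xi i (F 0) y 1 * D.xi i (F 1) y 0)) x := m01.add m10'
    rw [e, dirDeriv_mul hcx m, dirDeriv_add m01 m10', dirDeriv_neg _ _ m10,
      dirDeriv_mul (s (F 0) 0) (s (F 1) 1), dirDeriv_mul (s (F 0) 1) (s (F 1) 0)]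
    ring
  have e₁ : (D.lieAlgebroid hS).extD₁ η.cochain X x =
      ∑ i : Fin 3, (-1 : ℂ) ^ (i : ℕ) *
        dirDeriv (η.cochain fun m : Fin 2 => X (i.succAbove m)) x (D.secVF (X i) x) := rfl
  have e₂ : (D.lieAlgebroid hS).extD₂ η.cochain X x =
      ∑ j : Fin 3, ∑ i : Fin 2, if i.castSucc < j then (-1 : ℂ) ^ ((i : ℕ) + (j : ℕ)) *
        η.cochain (Fin.cons ((D.lieAlgebroid hS).bracket (X i.castSucc) (X j))
          (fun m : Fin 1 => X (j.succAbove (i.succAbove m)))) x else 0 := rfl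
  have s00 : Fin.succAbove (0 : Fin 3) (0 : Fin 2) = 1 := rfl
  have s01 : Fin.succAbove (0 : Fin 3) (1 : Fin 2) = 2 := rfl
  have s10 : Fin.succAbove (1 : Fin 3) (0 : Fin 2) = 0 := rfl
  have s11 : Fin.succAbove (1 : Fin 3) (1 : Fin 2) = 2 := rfl
  have s20 : Fin.succAbove (2 : Fin 3) (0 : Fin 2) = 0 := rfl
  have s21 : Fin.succAbove (2 : Fin 3) (1 : Fin 2) = 1 := rfl
  have t0 : Fin.succAbove (0 : Fin 2) (0 : Fin 1) = 1 := rfl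
  have t1 : Fin.succAbove (1 : Fin 2) (0 : Fin 1) = 0 := rfl
  have c0 : Fin.castSucc (0 : Fin 2) = 0 := rfl
  have c1 : Fin.castSucc (1 : Fin 2) = 1 := rfl
  have p3 : ((2 : Fin 3) : ℕ) = 2 := rfl
  have i00 : ¬ (0 : Fin 3) < 0 := by decide
  have i10 : ¬ (1 : Fin 3) < 0 := by decide
  have i01 : (0 : Fin 3) < 1 := by decide
  have i11 : ¬ (1 : Fin 3) < 1 := by decide
  have i02 : (0 : Fin 3) < 2 := by decide
  have i12 : (1 : Fin 3) < 2 := by decide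
  have e : (D.lieAlgebroid hS).extD η.cochain X x =
      (D.lieAlgebroid hS).extD₁ η.cochain X x + (D.lieAlgebroid hS).extD₂ η.cochain X x := rfl
  rw [e, e₁, e₂]
  simp only [Fin.sum_univ_three, Fin.sum_univ_two, c0, c1, i00, i10, i01, i11, i02, i12, if_true,
    if_false, der, val _ hx, s00, s01, s10, s11, s20, s21, Fin.cons_zero, Fin.cons_one, t0, t1,
    D.xi_bracket hS _ _ hx, D.dirDeriv_secVF _ _ hx, Fin.val_zero, Fin.val_one, p3,
    structFun_self, D.structFun_swap x 1 0]
  ring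

end Dyad

end ShearFree

theorem mainTheorem6 {M : Type u} [TopologicalSpace M] [T2Space M] [SecondCountableTopology M]
    [ChartedSpace ShearFree.E4 M] [IsManifold (𝓡 4) ∞ M]
    (c : ShearFree.ConformalStructure M) (g : ShearFree.Metric M) (hg : g ∈ c.reps)
    (𝔖 : ShearFree.SpinStructure.{u, v} g)
    (b : ShearFree.ProjectiveSpinorField 𝔖)
    (hb : ∀ β ∈ b.reps, ShearFree.IsShearFree β)
    (D : ShearFree.Dyad 𝔖) (hD : D.β ∈ b.reps) :
    ∃ 𝓐 : ShearFree.LieAlgebroid D.L,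
      -- the anchor is the projector `P`
      (∀ i, ∀ x ∈ 𝔖.U i, ∀ v : D.L.Fib x, 𝓐.anchor x v = D.P i x (D.toCT v)) ∧
      -- the bracket
      (∀ (X Y : ShearFree.Γ D.L) (i), ∀ x ∈ 𝔖.U i, ∀ A A' : Fin 2,
        D.vecComp i (𝓐.bracket X Y) x (A, A') = D.bracketRHS i X Y x A A') ∧
      -- the exterior derivative of functions
      (∀ (f : C^∞⟮𝓡 4, M; 𝓘(ℝ, ℂ), ℂ⟯) (X : Fin 1 → ShearFree.Γ D.L) (i), ∀ x ∈ 𝔖.U i,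
        𝓐.extD (ShearFree.cochain₀ D.L f) X x =
          ∑ A, ∑ A', D.dFunRHS i f x A A' * D.vecComp i (X 0) x (A, A')) ∧
      -- the exterior derivative of 1-forms
      (∀ (η : ShearFree.BForm D.L 1) (X : Fin 2 → ShearFree.Γ D.L) (i), ∀ x ∈ 𝔖.U i,
        𝓐.extD η.cochain X x =
          ∑ A, ∑ A', ∑ B, ∑ B', D.dFormRHS i η x A A' B B' *
            D.vecComp i (X 0) x (A, A') * D.vecComp i (X 1) x (B, B')) ∧
      -- the exterior derivative in degrees `k ≥ 2`
      (∀ (k : ℕ), 2 ≤ k → ∀ (η : ShearFree.BForm D.L k) (X : Fin (k + 1) → ShearFree.Γ D.L)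
        (x : M), 𝓐.extD η.cochain X x = 0) ∧
      -- the generalized Lie derivative of 1-forms
      (∀ (X : ShearFree.Γ D.L) (η : ShearFree.BForm D.L 1) (Y : Fin 1 → ShearFree.Γ D.L) (i),
        ∀ x ∈ 𝔖.U i,
        𝓐.lieD X η.cochain Y x =
          ∑ A, ∑ A', D.lieRHS i X η x A A' * D.vecComp i (Y 0) x (A, A')) := by
  have hS := hb D.β hD
  refine ⟨D.lieAlgebroid hS, fun i x hx v => (D.P_toCT hx v).symm,
    fun X Y i x hx A A' => D.vecComp_bracket hS X Y hx A A',
    fun f X i x hx => D.extD_function hS f X hx,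
    fun η X i x hx => D.extD_one_form_components hS η X hx, ?_,
    fun X η Y i x hx => D.lieD_one_form hS X η Y hx⟩
  intro k hk η X x
  obtain rfl | hk := hk.eq_or_lt
  · exact D.extD_two_form hS η X x
  · rw [D.cochain_eq_zero hk η]
    exact D.extD_zero _ X x
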